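/- Let $\lambda$-terms be given by $t,u ::= x \mid \lambda x.t \mid t\,u$, and terms with explicit substitutions by $t,u ::= x \mid \lambda x.t \mid t\,u \mid t[x/u]$, where both $\lambda x.t$ and $t[x/u]$ bind $x$ in $t$; terms are considered up to $\alpha$-conversion, and $\mathrm{fv}(t)$ is the set of free variables of $t$. The $\lambda\mathtt{es}$-calculus has the rewriting rules $$\begin{array}{lll} (\lambda x.t)\,u &\to& t[x/u]\\ x[x/u] &\to& u\\ t[x/u] &\to& t \quad\text{if } x\notin\mathrm{fv}(t)\\ (t\,v)[x/u] &\to& t\;v[x/u] \quad\text{if } x\notin\mathrm{fv}(t),\ x\in\mathrm{fv}(v)\\ (t\,v)[x/u] &\to& t[x/u]\;v \quad\text{if } x\in\mathrm{fv}(t),\ x\notin\mathrm{fv}(v)\\ (t\,v)[x/u] &\to& t[x/u]\;v[x/u] \quad\text{if } x\in\mathrm{fv}(t),\ x\in\mathrm{fv}(v)\\ (\lambda y.t)[x/u] &\to& \lambda y.(t[x/u])\\ t[x/u][y/v] &\to& t[x/u[y/v]] \quad\text{if } y\notin\mathrm{fv}(t),\ y\in\mathrm{fv}(u)\\ t[x/u][y/v]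 &\to& t[y/v][x/u[y/v]] \quad\text{if } y\in\mathrm{fv}(t),\ y\in\mathrm{fv}(u) \end{array}$$ and the equation $$t[x/u][y/v]\ \sim_{\mathtt{CS}}\ t[y/v][x/u]\quad\text{if } y\notin\mathrm{fv}(u),\ x\notin\mathrm{fv}(v),\ x\neq y,$$ where bound variables are chosen so that no free variable is captured (in particular $y\neq x$ and $y\notin\mathrm{fv}(u)$ in the rule for $\lambda y.t$, and $x\ne y$, $x\notin\mathrm{fv}(v)$ in the last two rules). Let $\equiv_{\mathtt{CS}}$ be the equivalence relation generated by the closure of $\sim_{\mathtt{CS}}$ under all contexts, let $\to$ also denote the closure of the rules under all contexts, and let $t\to_{\lambda\mathtt{es}}u$ mean that $t\equiv_{\mathtt{CS}}t'\to u'\equiv_{\mathtt{CS}}u$ for some $t',u'$. Then the $\lambda\mathtt{es}$-calculus enjoys preservation of $\beta$-strong normalization (PSN): for every $\lambda$-term $t$, if there is no infinite $\beta$-reduction sequence starting at $t$, then there is no infinite $\to_{\lambda\mathtt{es}}$-reduction sequence starting at $t$. -/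

import Mathlib

namespace LambdaES

/-! ## Abstract rewriting -/

/-- `a` is strongly normalizing for `R`: no infinite `R`-reduction sequence starts at `a`. -/
def SN {α : Type} (R : α → α → Prop) (a : α) : Prop :=
  ¬ ∃ f : ℕ → α, f 0 = a ∧ ∀ n, R (f n) (f (n + 1))

/-- Reduction `R` modulo `E`: `t` reduces to `u` iff `t E t'`, `t' R u'` and `u' E u`
for some `t'`, `u'`. -/
def Modulo {α : Type} (R E : α → α → Prop) (t u : α) : Prop :=
  ∃ t' u', E t t' ∧ R t' u' ∧ E u' u

/-! ## The lambda-calculus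

Terms up to alpha-conversion, in de Bruijn notation. In a scope `x₀, x₁, x₂, …` the variable `xᵢ`
is `var i`; going under a binder puts the bound variable in front of the scope. The scope is
infinite, so open terms are included. -/

/-- Lambda-terms `t, u ::= x | λx.t | t u`. -/
inductive Lam : Type where
  | var (i : ℕ) : Lam
  | lam (t : Lam) : Lam
  | app (t u : Lam) : Lam

/-- A renaming extended under one binder. -/
def upRen (ρ : ℕ → ℕ) : ℕ → ℕ
  | 0 => 0
  | i + 1 => ρ i + 1

namespace Lam

/-- Renaming of the free variables. -/
def rename : (ℕ → ℕ) → Lam → Lam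
  | ρ, var i => var (ρ i)
  | ρ, lam t => lam (rename (upRen ρ) t)
  | ρ, app t u => app (rename ρ t) (rename ρ u)

/-- A substitution extended under one binder (capture avoiding). -/
def upSubst (σ : ℕ → Lam) : ℕ → Lam
  | 0 => var 0
  | i + 1 => rename Nat.succ (σ i)

/-- Simultaneous capture-avoiding substitution. -/
def subst : (ℕ → Lam) → Lam → Lam
  | σ, var i => σ i
  | σ, lam t => lam (subst (upSubst σ) t)
  | σ, app t u => app (subst σ t) (subst σ u)

/-- `t{x/u}`, where `x` is the variable `0` of `t`; it disappears from the scope. -/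
def inst (t u : Lam) : Lam :=
  subst (fun i => match i with
    | 0 => u
    | j + 1 => var j) t

end Lam

/-- Beta-reduction: the closure by contexts of `(λx.t) u ↦ t{x/u}`. -/
inductive Beta : Lam → Lam → Prop where
  | beta (t u : Lam) : Beta (.app (.lam t) u) (t.inst u)
  | lam {t t' : Lam} : Beta t t' → Beta (.lam t) (.lam t')
  | appL {t t' : Lam} (u : Lam) : Beta t t' → Beta (.app t u) (.app t' u)
  | appR (t : Lam) {u u' : Lam} : Beta u u' → Beta (.app t u) (.app t u')

/-! ## Terms with explicit substitutions -/

/-- Terms `t, u ::= x | λx.t | t u | t[x/u]`, up to alpha-conversion. In `sub t u`, which is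
`t[x/u]`, the variable `x` is the variable `0` of `t` and is not in the scope of `u`. -/
inductive Term : Type where
  | var (i : ℕ) : Term
  | lam (t : Term) : Term
  | app (t u : Term) : Term
  | sub (t u : Term) : Term

/-- Lambda-terms are terms (without explicit substitutions). -/
def Lam.toTerm : Lam → Term
  | .var i => .var i
  | .lam t => .lam t.toTerm
  | .app t u => .app t.toTerm u.toTerm

namespace Term

/-- `Free i t`: the variable `i` occurs free in `t`. -/
def Free : ℕ → Term → Prop
  | i, var j => i = j
  | i, lam t => Free (i + 1) t
  | i, app t u => Free i t ∨ Free i u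
  | i, sub t u => Free (i + 1) t ∨ Free i u

/-- Renaming of the free variables. -/
def rename : (ℕ → ℕ) → Term → Term
  | ρ, var i => var (ρ i)
  | ρ, lam t => lam (rename (upRen ρ) t)
  | ρ, app t u => app (rename ρ t) (rename ρ u)
  | ρ, sub t u => sub (rename (upRen ρ) t) (rename ρ u)

/-- The same named term, seen in the scope with one more variable put in front. -/
def weaken (t : Term) : Term := rename Nat.succ t

/-- The same named term, seen in the scope without its first variable. Only used if the variable
`0` is not free in `t`. -/
def strengthen (t : Term) : Term := rename Nat.pred t

/-- The same named term, seen in the scope where the first two variables are exchanged. -/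
def exchange (t : Term) : Term := rename (Equiv.swap 0 1) t

end Term

open Term in
/-- The rewriting rules of the calculus of explicit substitutions `λes`, at the root of a term.

In the rules on `(t v)[x/u]` the variable `x` is `0` in `t` and in `v`. In `(λy.t)[x/u]` the
variables `y, x` are `0, 1` in `t`. In `t[x/u][y/v]` the variables `x, y` are `0, 1` in `t`, and
`y` is `0` in `u`. -/
inductive Rule : Term → Term → Prop where
  /-- `(λx.t) u → t[x/u]` -/
  | b (t u : Term) : Rule (app (lam t) u) (sub t u)
  /-- `x[x/u] → u` -/
  | d (u : Term) : Rule (sub (var 0) u) u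
  /-- `t[x/u] → t` if `x ∉ fv(t)` -/
  | w (t u : Term) (ht : ¬ Free 0 t) : Rule (sub t u) (strengthen t)
  /-- `(t v)[x/u] → t v[x/u]` if `x ∉ fv(t)` and `x ∈ fv(v)` -/
  | appRight (t v u : Term) (ht : ¬ Free 0 t) (hv : Free 0 v) :
      Rule (sub (app t v) u) (app (strengthen t) (sub v u))
  /-- `(t v)[x/u] → t[x/u] v` if `x ∈ fv(t)` and `x ∉ fv(v)` -/
  | appLeft (t v u : Term) (ht : Free 0 t) (hv : ¬ Free 0 v) :
      Rule (sub (app t v) u) (app (sub t u) (strengthen v))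
  /-- `(t v)[x/u] → t[x/u] v[x/u]` if `x ∈ fv(t)` and `x ∈ fv(v)` -/
  | appBoth (t v u : Term) (ht : Free 0 t) (hv : Free 0 v) :
      Rule (sub (app t v) u) (app (sub t u) (sub v u))
  /-- `(λy.t)[x/u] → λy.t[x/u]` -/
  | lam (t u : Term) :
      Rule (sub (lam t) u) (lam (sub (exchange t) (weaken u)))
  /-- `t[x/u][y/v] → t[x/u[y/v]]` if `y ∉ fv(t)` and `y ∈ fv(u)` -/
  | comp₁ (t u v : Term) (ht : ¬ Free 1 t) (hu : Free 0 u) :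
      Rule (sub (sub t u) v) (sub (strengthen (exchange t)) (sub u v))
  /-- `t[x/u][y/v] → t[y/v][x/u[y/v]]` if `y ∈ fv(t)` and `y ∈ fv(u)` -/
  | comp₂ (t u v : Term) (ht : Free 1 t) (hu : Free 0 u) :
      Rule (sub (sub t u) v) (sub (sub (exchange t) (weaken v)) (sub u v))

open Term in
/-- The equation `t[x/u][y/v] ∼ t[y/v][x/u]` if `y ∉ fv(u)` and `x ∉ fv(v)`, at the root of a
term. The second condition holds in this notation, since `x` is not in the scope of `v`. -/
inductive EqCS : Term → Term → Prop where
  | cs (t u v : Term) (hu : ¬ Free 0 u) :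
      EqCS (sub (sub t u) v) (sub (sub (exchange t) (weaken v)) (strengthen u))

/-- Closure of a relation by the contexts
`C ::= □ | C v | v C | v[y/C] | C[y/v] | λy.C`. -/
inductive Closure (R : Term → Term → Prop) : Term → Term → Prop where
  | root {t t' : Term} : R t t' → Closure R t t'
  | lam {t t' : Term} : Closure R t t' → Closure R (.lam t) (.lam t')
  | appL {t t' : Term} (u : Term) : Closure R t t' → Closure R (.app t u) (.app t' u)
  | appR (t : Term) {u u' : Term} : Closure R u u' → Closure R (.app t u) (.app t u')
  | subL {t t' : Term} (u : Term) : Closure R t t' → Closure R (.sub t u) (.sub t' u)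
  | subR (t : Term) {u u' : Term} : Closure R u u' → Closure R (.sub t u) (.sub t u')

/-- The equivalence `≡CS` generated by the equation, closed by contexts. -/
def EquivCS : Term → Term → Prop := Relation.EqvGen (Closure EqCS)

/-- The reduction relation of `λes`: the closure by contexts of the rules, modulo `≡CS`. -/
def Les : Term → Term → Prop := Modulo (Closure Rule) EquivCS

end LambdaES

/-! The heart of the matter is that implicit substitution controls explicit substitution: if `u` and
`t{x/u} v₁ … vₙ` are strongly normalizing for `Les`, then so is `t[x/u] v₁ … vₙ`. Given this, PSN
follows by induction on β-reduction and the subterm order together. An abstraction or a variable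
applied to terms has no head redex, now or later, so its subterms decide. Otherwise the head redex
can be contracted to an explicit substitution first (`HeadB.acc`). Its body is a proper subterm, and
executing it gives a β-reduct, so the induction hypothesis covers both.

For the key fact (`Marked.acc_forget`), the new substitution is marked and its residuals are
followed. `forget` is the actual term, `eval` is the term with the marked substitutions executed.
Marked bodies contain no variable bound around them inside the term, so they live in one global
scope. No substitution ever enters them, and a step inside one is a step of the original body.

Each step of `forget` lifts to marked terms (`lift_les`). Either `eval` makes at least one step,
which its strong normalization bounds, or `eval` is unchanged up to the equation and a lexicographic
triple decreases: `prop`, weighted occurrences of the variables of marked substitutions, drops when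
a marked substitution is propagated, dropped or performed; `cross` drops when a void one, whose
variable does not occur, crosses an abstraction, the only propagation that `prop` misses; `ranks`,
the multiset of ordinal ranks of the bodies, drops when a body reduces invisibly to `eval`. All
three are invariant under the equation, so working modulo it does no harm. -/

namespace LambdaES

/-! ## Substitution in terms with explicit substitutions -/

namespace Term

/-- A substitution extended under one binder (capture avoiding). -/
def upSubst (σ : ℕ → Term) : ℕ → Term
  | 0 => var 0
  | i + 1 => rename Nat.succ (σ i)

/-- Simultaneous capture-avoiding substitution. -/
def subst : (ℕ → Term) → Term → Term
  | σ, var i => σ i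
  | σ, lam t => lam (subst (upSubst σ) t)
  | σ, app t u => app (subst σ t) (subst σ u)
  | σ, sub t u => sub (subst (upSubst σ) t) (subst σ u)

/-- The substitution of `u` for the variable `0`, which disappears from the scope. -/
def single (u : Term) : ℕ → Term
  | 0 => u
  | i + 1 => var i

@[simp] theorem upSubst_zero (σ : ℕ → Term) : upSubst σ 0 = var 0 := rfl
@[simp] theorem upSubst_succ (σ : ℕ → Term) (i : ℕ) :
    upSubst σ (i + 1) = rename Nat.succ (σ i) := rfl
@[simp] theorem single_zero (u : Term) : single u 0 = u := rfl
@[simp] theorem single_succ (u : Term) (i : ℕ) : single u (i + 1) = var i := rfl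

end Term

@[simp] theorem upRen_zero (ρ : ℕ → ℕ) : upRen ρ 0 = 0 := rfl
@[simp] theorem upRen_succ (ρ : ℕ → ℕ) (i : ℕ) : upRen ρ (i + 1) = ρ i + 1 := rfl

theorem upRen_comp (ρ ρ' : ℕ → ℕ) : upRen ρ ∘ upRen ρ' = upRen (ρ ∘ ρ') := by
  funext i; cases i <;> rfl

namespace Term

theorem rename_rename (t : Term) : ∀ ρ ρ' : ℕ → ℕ,
    rename ρ (rename ρ' t) = rename (ρ ∘ ρ') t := by
  induction t <;> intro ρ ρ' <;> simp_all [rename, upRen_comp]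

theorem subst_congr {t : Term} : ∀ {σ τ : ℕ → Term}, (∀ i, Free i t → σ i = τ i) →
    subst σ t = subst τ t := by
  have up : ∀ {t : Term} {σ τ : ℕ → Term}, (∀ i, Free (i + 1) t → σ i = τ i) →
      ∀ i, Free i t → upSubst σ i = upSubst τ i := by
    rintro t σ τ h (_ | i) hi
    · rfl
    · simp [h i hi]
  induction t with
  | var i => exact fun h => h i rfl
  | lam t ih => exact fun h => congrArg lam (ih (up h))
  | app t u iht ihu =>
    exact fun h => congrArg₂ app (iht fun i hi => h i (.inl hi)) (ihu fun i hi => h i (.inr hi))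
  | sub t u iht ihu =>
    exact fun h => congrArg₂ sub (iht (up fun i hi => h i (.inl hi)))
      (ihu fun i hi => h i (.inr hi))

theorem rename_eq_subst (t : Term) : ∀ ρ : ℕ → ℕ, rename ρ t = subst (fun i => var (ρ i)) t := by
  have up : ∀ ρ : ℕ → ℕ, (fun i => var (upRen ρ i)) = upSubst (fun i => var (ρ i)) := by
    intro ρ; funext i; cases i <;> rfl
  induction t <;> intro ρ <;> simp_all [rename, subst]

theorem subst_var (t : Term) : subst var t = t := by
  have up : upSubst var = var := by
    funext i; cases i <;> rfl
  induction t <;> simp_all [subst]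

theorem subst_rename (t : Term) : ∀ (σ : ℕ → Term) (ρ : ℕ → ℕ),
    subst σ (rename ρ t) = subst (fun i => σ (ρ i)) t := by
  have up : ∀ (σ : ℕ → Term) (ρ : ℕ → ℕ),
      (fun i => upSubst σ (upRen ρ i)) = upSubst (fun i => σ (ρ i)) := by
    intro σ ρ; funext i; cases i <;> rfl
  induction t <;> intro σ ρ <;> simp_all [rename, subst]

theorem rename_subst (t : Term) : ∀ (ρ : ℕ → ℕ) (σ : ℕ → Term),
    rename ρ (subst σ t) = subst (fun i => rename ρ (σ i)) t := by
  have up : ∀ (ρ : ℕ → ℕ) (σ : ℕ → Term),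
      (fun i => rename (upRen ρ) (upSubst σ i)) = upSubst (fun i => rename ρ (σ i)) := by
    intro ρ σ; funext i
    cases i
    · rfl
    · simp only [upSubst_succ, rename_rename]; rfl
  induction t <;> intro ρ σ <;> simp_all [rename, subst]

theorem subst_subst (t : Term) : ∀ σ τ : ℕ → Term,
    subst σ (subst τ t) = subst (fun i => subst σ (τ i)) t := by
  have up : ∀ σ τ : ℕ → Term,
      (fun i => subst (upSubst σ) (upSubst τ i)) = upSubst (fun i => subst σ (τ i)) := by
    intro σ τ; funext i
    cases i
    · rfl
    · simp only [upSubst_succ, subst_rename, rename_subst]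
  induction t <;> intro σ τ <;> simp_all [subst]

/-! ### Free variables of renamed and substituted terms -/

theorem free_rename (t : Term) : ∀ (i : ℕ) (ρ : ℕ → ℕ),
    Free i (rename ρ t) ↔ ∃ j, Free j t ∧ ρ j = i := by
  have up : ∀ (P : ℕ → Prop) (i : ℕ) (ρ : ℕ → ℕ),
      (∃ j, P j ∧ upRen ρ j = i + 1) ↔ ∃ j, P (j + 1) ∧ ρ j = i := by
    intro P i ρ
    constructor
    · rintro ⟨_ | j, hj, h⟩
      · simp at h
      · exact ⟨j, hj, by simpa using h⟩
    · rintro ⟨j, hj, h⟩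
      exact ⟨j + 1, hj, by simpa using h⟩
  induction t with
  | var k => intro i ρ; simp [rename, Free, eq_comm]
  | lam t ih => intro i ρ; simp only [rename, Free, ih, up]
  | app t u iht ihu => intro i ρ; simp only [rename, Free, iht, ihu, or_and_right, exists_or]
  | sub t u iht ihu => intro i ρ; simp only [rename, Free, iht, ihu, up, or_and_right, exists_or]

theorem free_subst (t : Term) : ∀ (i : ℕ) (σ : ℕ → Term),
    Free i (subst σ t) ↔ ∃ j, Free j t ∧ Free i (σ j) := by
  have up : ∀ (P : ℕ → Prop) (i : ℕ) (σ : ℕ → Term),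
      (∃ j, P j ∧ Free (i + 1) (upSubst σ j)) ↔ ∃ j, P (j + 1) ∧ Free i (σ j) := by
    intro P i σ
    constructor
    · rintro ⟨_ | j, hj, h⟩
      · simp [Free] at h
      · exact ⟨j, hj, by simpa [free_rename] using h⟩
    · rintro ⟨j, hj, h⟩
      exact ⟨j + 1, hj, by simpa [free_rename] using h⟩
  induction t with
  | var k => intro i σ; simp [subst, Free]
  | lam t ih => intro i σ; simp only [subst, Free, ih, up]
  | app t u iht ihu => intro i σ; simp only [subst, Free, iht, ihu, or_and_right, exists_or]
  | sub t u iht ihu => intro i σ; simp only [subst, Free, iht, ihu, up, or_and_right, exists_or]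

theorem free_upSubst_zero (σ : ℕ → Term) (t : Term) :
    Free 0 (subst (upSubst σ) t) ↔ Free 0 t := by
  rw [free_subst]
  constructor
  · rintro ⟨_ | j, hj, h⟩
    · exact hj
    · simp [free_rename] at h
  · exact fun h => ⟨0, h, rfl⟩

theorem free_upSubst_one (σ : ℕ → Term) (t : Term) :
    Free 1 (subst (upSubst (upSubst σ)) t) ↔ Free 1 t := by
  rw [free_subst]
  constructor
  · rintro ⟨_ | _ | j, hj, h⟩
    · simp [Free] at h
    · exact hj
    · simp [free_rename] at h
  · exact fun h => ⟨1, h, rfl⟩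

/-! ### Changes of scope: commutation with substitution, inverses, free variables -/

theorem weaken_subst (σ : ℕ → Term) (t : Term) :
    weaken (subst σ t) = subst (upSubst σ) (weaken t) := by
  simp only [weaken, rename_subst, subst_rename, upSubst_succ, Nat.succ_eq_add_one]

theorem strengthen_subst (σ : ℕ → Term) {t : Term} (ht : ¬ Free 0 t) :
    strengthen (subst (upSubst σ) t) = subst σ (strengthen t) := by
  simp only [strengthen, rename_subst, subst_rename]
  -- `Nat.pred` also sends `0` to `0`, so the two substitutions may differ there; agreement on the
  -- free variables is enough.
  refine subst_congr ?_
  rintro (_ | i) hi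
  · exact absurd hi ht
  · simp only [upSubst_succ, rename_rename, Nat.pred_succ]
    rw [rename_eq_subst]
    exact subst_var _

theorem exchange_subst (σ : ℕ → Term) (t : Term) :
    exchange (subst (upSubst (upSubst σ)) t) = subst (upSubst (upSubst σ)) (exchange t) := by
  simp only [exchange, rename_subst, subst_rename]
  congr 1
  funext i
  rcases i with _ | _ | i
  · simp [rename]
  · simp [rename]
  · have h : Equiv.swap 0 1 (i + 1 + 1) = i + 1 + 1 :=
      Equiv.swap_apply_of_ne_of_ne (by omega) (by omega)
    simp only [h, upSubst_succ, rename_rename]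
    congr 1

theorem exchange_exchange (t : Term) : exchange (exchange t) = t := by
  rw [exchange, exchange, rename_rename, rename_eq_subst]
  simpa using subst_var t

theorem strengthen_weaken (t : Term) : strengthen (weaken t) = t := by
  rw [strengthen, weaken, rename_rename, rename_eq_subst]
  simpa using subst_var t

theorem weaken_strengthen {t : Term} (ht : ¬ Free 0 t) : weaken (strengthen t) = t := by
  rw [strengthen, weaken, rename_rename, rename_eq_subst]
  conv_rhs => rw [← subst_var t]
  refine subst_congr ?_
  rintro (_ | i) hi
  · exact absurd hi ht
  · rfl

theorem free_weaken_zero (t : Term) : ¬ Free 0 (weaken t) := by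
  simp [weaken, free_rename]

theorem free_weaken_succ (t : Term) (i : ℕ) : Free (i + 1) (weaken t) ↔ Free i t := by
  simp [weaken, free_rename]

theorem free_strengthen {t : Term} (ht : ¬ Free 0 t) (i : ℕ) :
    Free i (strengthen t) ↔ Free (i + 1) t := by
  rw [← free_weaken_succ, weaken_strengthen ht]

theorem free_exchange (t : Term) (i : ℕ) :
    Free i (exchange t) ↔ Free (Equiv.swap 0 1 i) t := by
  rw [exchange, free_rename]
  constructor
  · rintro ⟨j, hj, rfl⟩
    simpa using hj
  · exact fun h => ⟨_, h, by simp⟩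

theorem free_exchange_zero (t : Term) : Free 0 (exchange t) ↔ Free 1 t := by
  simp [free_exchange]

theorem free_exchange_succ_succ (t : Term) (i : ℕ) :
    Free (i + 1 + 1) (exchange t) ↔ Free (i + 1 + 1) t := by
  rw [free_exchange, Equiv.swap_apply_of_ne_of_ne (by omega) (by omega)]

end Term

open Term

/-! ## Stability of reduction -/

/-- The side conditions mention only variables bound in the redex, and a lifted substitution neither
removes nor creates occurrences of these. -/
theorem Rule.subst {t t' : Term} (h : Rule t t') (σ : ℕ → Term) :
    Rule (t.subst σ) (t'.subst σ) := by
  cases h with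
  | b t u => exact .b _ _
  | d u => exact .d _
  | w t u ht =>
    rw [← strengthen_subst σ ht]
    exact .w _ _ (by rwa [free_upSubst_zero])
  | appRight t v u ht hv =>
    simp only [Term.subst, ← strengthen_subst σ ht]
    exact .appRight _ _ _ (by rwa [free_upSubst_zero]) (by rwa [free_upSubst_zero])
  | appLeft t v u ht hv =>
    simp only [Term.subst, ← strengthen_subst σ hv]
    exact .appLeft _ _ _ (by rwa [free_upSubst_zero]) (by rwa [free_upSubst_zero])
  | appBoth t v u ht hv =>
    exact .appBoth _ _ _ (by rwa [free_upSubst_zero]) (by rwa [free_upSubst_zero])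
  | lam t u =>
    simp only [Term.subst, ← exchange_subst, ← weaken_subst]
    exact .lam _ _
  | comp₁ t u v ht hu =>
    have h0 : ¬ Free 0 (exchange t) := by rwa [free_exchange_zero]
    simp only [Term.subst, ← strengthen_subst _ h0, ← exchange_subst]
    exact .comp₁ _ _ _ (by rwa [free_upSubst_one]) (by rwa [free_upSubst_zero])
  | comp₂ t u v ht hu =>
    simp only [Term.subst, ← exchange_subst, ← weaken_subst]
    exact .comp₂ _ _ _ (by rwa [free_upSubst_one]) (by rwa [free_upSubst_zero])

theorem EqCS.subst {t t' : Term} (h : EqCS t t') (σ : ℕ → Term) :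
    EqCS (t.subst σ) (t'.subst σ) := by
  cases h with
  | cs t u v hu =>
    simp only [Term.subst, ← exchange_subst, ← weaken_subst, ← strengthen_subst σ hu]
    exact .cs _ _ _ (by rwa [free_upSubst_zero])

/-- Commuting twice restores the term: `exchange` is an involution, and `weaken` and `strengthen`
cancel. -/
theorem EqCS.symm {t t' : Term} (h : EqCS t t') : EqCS t' t := by
  cases h with
  | cs t u v hu =>
    have := EqCS.cs (exchange t) (weaken v) (strengthen u) (free_weaken_zero v)
    rwa [exchange_exchange, weaken_strengthen hu, strengthen_weaken] at this

theorem Rule.free {t t' : Term} (h : Rule t t') (i : ℕ) : Free i t' → Free i t := by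
  cases h with
  | b t u => exact id
  | d u => exact Or.inr
  | w t u ht => rw [free_strengthen ht]; exact Or.inl
  | appRight t v u ht hv => simp only [Free, free_strengthen ht]; tauto
  | appLeft t v u ht hv => simp only [Free, free_strengthen hv]; tauto
  | appBoth t v u ht hv => simp only [Free]; tauto
  | lam t u => simp only [Free, free_exchange_succ_succ, free_weaken_succ]; tauto
  | comp₁ t u v ht hu =>
    have h0 : ¬ Free 0 (exchange t) := by rwa [free_exchange_zero]
    simp only [Free, free_strengthen h0, free_exchange_succ_succ]; tauto
  | comp₂ t u v ht hu => simp only [Free, free_exchange_succ_succ, free_weaken_succ]; tauto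

theorem EqCS.free {t t' : Term} (h : EqCS t t') (i : ℕ) : Free i t' → Free i t := by
  cases h with
  | cs t u v hu =>
    simp only [Free, free_exchange_succ_succ, free_weaken_succ, free_strengthen hu]; tauto

namespace Closure

theorem subst {R : Term → Term → Prop}
    (hR : ∀ {t t'}, R t t' → ∀ σ, R (t.subst σ) (t'.subst σ)) {t t' : Term}
    (h : Closure R t t') : ∀ σ, Closure R (t.subst σ) (t'.subst σ) := by
  induction h with
  | root h => exact fun σ => .root (hR h σ)
  | lam _ ih => exact fun σ => .lam (ih _)
  | appL _ _ ih => exact fun σ => .appL _ (ih _)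
  | appR _ _ ih => exact fun σ => .appR _ (ih _)
  | subL _ _ ih => exact fun σ => .subL _ (ih _)
  | subR _ _ ih => exact fun σ => .subR _ (ih _)

theorem symm {R : Term → Term → Prop} (hR : ∀ {t t'}, R t t' → R t' t) {t t' : Term}
    (h : Closure R t t') : Closure R t' t := by
  induction h with
  | root h => exact .root (hR h)
  | lam _ ih => exact .lam ih
  | appL _ _ ih => exact .appL _ ih
  | appR _ _ ih => exact .appR _ ih
  | subL _ _ ih => exact .subL _ ih
  | subR _ _ ih => exact .subR _ ih

theorem free {R : Term → Term → Prop} (hR : ∀ {t t'}, R t t' → ∀ i, Free i t' → Free i t)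
    {t t' : Term} (h : Closure R t t') : ∀ i, Free i t' → Free i t := by
  induction h with
  | root h => exact hR h
  | lam _ ih => exact fun i => ih _
  | appL _ _ ih => exact fun i => Or.imp_left (ih _)
  | appR _ _ ih => exact fun i => Or.imp_right (ih _)
  | subL _ _ ih => exact fun i => Or.imp_left (ih _)
  | subR _ _ ih => exact fun i => Or.imp_right (ih _)

/-- A step from a term seen in a scope with `k` more variables is a step of the term itself. -/
theorem of_rename_add {R : Term → Term → Prop}
    (hs : ∀ {t t'}, R t t' → ∀ σ, R (t.subst σ) (t'.subst σ))
    (hf : ∀ {t t'}, R t t' → ∀ i, Free i t' → Free i t) {u b : Term} {k : ℕ}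
    (h : Closure R (u.rename (· + k)) b) :
    ∃ u', b = u'.rename (· + k) ∧ Closure R u u' := by
  -- Truncated subtraction undoes the shift on `u`. On `b` it loses nothing, because steps create no
  -- free variables and so those of `b` are all at least `k`.
  refine ⟨b.rename (· - k), ?_, ?_⟩
  · rw [rename_rename, rename_eq_subst]
    conv_lhs => rw [← subst_var b]
    refine subst_congr fun i hi => ?_
    obtain ⟨j, -, rfl⟩ := (free_rename _ _ _).1 (h.free hf i hi)
    simp
  · have := h.subst hs fun i => var (i - k)
    rw [← rename_eq_subst, ← rename_eq_subst, rename_rename, rename_eq_subst u] at this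
    simpa [Function.comp_def, subst_var] using this

end Closure

/-! ### The equivalence and reduction modulo it -/

namespace EquivCS

theorem refl (t : Term) : EquivCS t t := Relation.EqvGen.refl t

theorem symm {t u : Term} (h : EquivCS t u) : EquivCS u t := Relation.EqvGen.symm _ _ h

theorem trans {t u v : Term} (h : EquivCS t u) (h' : EquivCS u v) : EquivCS t v :=
  Relation.EqvGen.trans _ _ _ h h'

theorem of_step {t u : Term} (h : Closure EqCS t u) : EquivCS t u := Relation.EqvGen.rel _ _ h

/-- Since the equation is symmetric, chains of forward steps suffice, and properties of the
equivalence can be proved one step at a time. -/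
theorem iff_reflTransGen {t u : Term} :
    EquivCS t u ↔ Relation.ReflTransGen (Closure EqCS) t u := by
  constructor
  · intro h
    induction h with
    | rel _ _ h => exact .single h
    | refl _ => exact .refl
    | symm _ _ _ ih =>
      have : Std.Symm (Closure EqCS) := ⟨fun _ _ h => h.symm EqCS.symm⟩
      exact Std.Symm.symm _ _ ih
    | trans _ _ _ _ _ ih ih' => exact ih.trans ih'
  · intro h
    induction h with
    | refl => exact .refl _
    | tail _ h ih => exact ih.trans (.of_step h)

theorem map {f : Term → Term} (hf : ∀ {a b}, Closure EqCS a b → Closure EqCS (f a) (f b))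
    {a b : Term} (h : EquivCS a b) : EquivCS (f a) (f b) := by
  induction h with
  | rel _ _ h => exact .of_step (hf h)
  | refl _ => exact .refl _
  | symm _ _ _ ih => exact ih.symm
  | trans _ _ _ _ _ ih ih' => exact ih.trans ih'

theorem subst {t u : Term} (h : EquivCS t u) (σ : ℕ → Term) :
    EquivCS (t.subst σ) (u.subst σ) := h.map fun h => h.subst EqCS.subst σ

end EquivCS

namespace Les

theorem of_step {t u : Term} (h : Closure Rule t u) : Les t u :=
  ⟨t, u, .refl t, h, .refl u⟩

theorem of_rule {t u : Term} (h : Rule t u) : Les t u := of_step (.root h)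

theorem equiv_left {t u v : Term} (h : EquivCS t u) : Les u v → Les t v :=
  fun ⟨a, b, ha, hab, hb⟩ => ⟨a, b, h.trans ha, hab, hb⟩

theorem equiv_right {t u v : Term} (h : EquivCS u v) : Les t u → Les t v :=
  fun ⟨a, b, ha, hab, hb⟩ => ⟨a, b, ha, hab, hb.trans h⟩

/-- Quantifying over all substitution-stable `R` lets a single proof about `f` serve both the rules
and the equation. -/
theorem map {f : Term → Term} (hf : ∀ R : Term → Term → Prop,
    (∀ {t t'}, R t t' → ∀ σ, R (t.subst σ) (t'.subst σ)) →
    ∀ {a b}, Closure R a b → Closure R (f a) (f b))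
    {a b : Term} : Les a b → Les (f a) (f b) :=
  fun ⟨a', b', ha, hab, hb⟩ => ⟨f a', f b', ha.map (hf EqCS EqCS.subst), hf Rule Rule.subst hab,
    hb.map (hf EqCS EqCS.subst)⟩

theorem lam {t t' : Term} (h : Les t t') : Les (.lam t) (.lam t') :=
  h.map fun _ _ _ _ h => .lam h
theorem appL {t t' : Term} (u : Term) (h : Les t t') : Les (.app t u) (.app t' u) :=
  h.map fun _ _ _ _ h => .appL u h
theorem appR (t : Term) {u u' : Term} (h : Les u u') : Les (.app t u) (.app t u') :=
  h.map fun _ _ _ _ h => .appR t h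
theorem subL {t t' : Term} (u : Term) (h : Les t t') : Les (.sub t u) (.sub t' u) :=
  h.map fun _ _ _ _ h => .subL u h
theorem subR (t : Term) {u u' : Term} (h : Les u u') : Les (.sub t u) (.sub t u') :=
  h.map fun _ _ _ _ h => .subR t h
theorem subst {t t' : Term} (h : Les t t') (σ : ℕ → Term) : Les (t.subst σ) (t'.subst σ) :=
  h.map fun _ hR _ _ h => h.subst hR σ

end Les

/-- A preorder compatible with contexts and renaming relates the results of related
substitutions. -/
theorem Term.subst_rel {Q : Term → Term → Prop} (refl : ∀ t, Q t t)
    (trans : ∀ {t u v}, Q t u → Q u v → Q t v)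
    (map : ∀ {f : Term → Term}, (∀ R : Term → Term → Prop,
      (∀ {t t'}, R t t' → ∀ σ, R (t.subst σ) (t'.subst σ)) →
      ∀ {a b}, Closure R a b → Closure R (f a) (f b)) → ∀ {a b}, Q a b → Q (f a) (f b))
    (t : Term) : ∀ {σ τ : ℕ → Term}, (∀ i, Q (σ i) (τ i)) → Q (t.subst σ) (t.subst τ) := by
  have up : ∀ {σ τ : ℕ → Term}, (∀ i, Q (σ i) (τ i)) → ∀ i, Q (upSubst σ i) (upSubst τ i) := by
    rintro σ τ h (_ | i)
    · exact refl _
    · simp only [upSubst_succ, rename_eq_subst]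
      exact map (fun R hR _ _ h => h.subst hR _) (h i)
  induction t with
  | var i => exact fun h => h i
  | lam t ih => exact fun h => map (fun _ _ _ _ h => .lam h) (ih (up h))
  | app t u iht ihu =>
    exact fun h => trans (map (f := (Term.app · _)) (fun _ _ _ _ h => .appL _ h) (iht h))
      (map (f := (Term.app _ ·)) (fun _ _ _ _ h => .appR _ h) (ihu h))
  | sub t u iht ihu =>
    exact fun h => trans (map (f := (Term.sub · _)) (fun _ _ _ _ h => .subL _ h) (iht (up h)))
      (map (f := (Term.sub _ ·)) (fun _ _ _ _ h => .subR _ h) (ihu h))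

theorem EquivCS.subst_right (t : Term) {σ τ : ℕ → Term} (h : ∀ i, EquivCS (σ i) (τ i)) :
    EquivCS (t.subst σ) (t.subst τ) :=
  t.subst_rel EquivCS.refl EquivCS.trans (fun hf _ _ h => h.map (hf EqCS EqCS.subst)) h

/-- The number of steps is not controlled: a substituted term may be erased or duplicated. -/
theorem Les.reflTransGen_subst_right (t : Term) {σ τ : ℕ → Term}
    (h : ∀ i, Relation.ReflTransGen Les (σ i) (τ i)) :
    Relation.ReflTransGen Les (t.subst σ) (t.subst τ) :=
  t.subst_rel (fun _ => .refl) (fun h h' => h.trans h')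
    (fun {f} hf _ _ h => h.lift f fun _ _ h => h.map hf) h

/-! ## Accessibility -/

theorem SN_iff_acc {α : Type} (R : α → α → Prop) (a : α) : SN R a ↔ Acc (flip R) a := by
  rw [SN, ← not_iff_not, not_not, not_acc_iff_exists_descending_chain]
  rfl

theorem EquivCS.acc {t u : Term} (h : EquivCS t u) (ht : Acc (flip Les) t) :
    Acc (flip Les) u :=
  ⟨u, fun _ hv => ht.inv (Les.equiv_left h hv)⟩

/-- The rank of a term in the reduction order (zero if the term is not strongly normalizing). -/
noncomputable def redRank (u : Term) : Ordinal :=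
  open Classical in if h : Acc (flip Les) u then h.rank else 0

theorem redRank_lt {u u' : Term} (hu : Acc (flip Les) u) (h : Les u u') :
    redRank u' < redRank u := by
  rw [redRank, redRank, dif_pos hu, dif_pos (hu.inv h)]
  exact hu.rank_lt_of_rel h

/-- Equivalent terms have exactly the same `Les`-reducts, and the rank depends only on these. -/
theorem redRank_equiv {u u' : Term} (h : EquivCS u u') : redRank u = redRank u' := by
  have key : ∀ {u u' : Term}, EquivCS u u' → ∀ (hu : Acc (flip Les) u) (hu' : Acc (flip Les) u'),
      hu.rank ≤ hu'.rank := by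
    intro u u' h hu hu'
    rw [hu.rank_eq]
    refine Ordinal.iSup_le fun b => Order.succ_le_of_lt ?_
    exact hu'.rank_lt_of_rel (Les.equiv_left h.symm b.2)
  by_cases hu : Acc (flip Les) u
  · have hu' := h.acc hu
    rw [redRank, redRank, dif_pos hu, dif_pos hu', le_antisymm (key h hu hu') (key h.symm hu' hu)]
  · have hu' : ¬ Acc (flip Les) u' := fun h' => hu (h.symm.acc h')
    rw [redRank, redRank, dif_neg hu, dif_neg hu']

/-! ### Executing a single substitution -/

namespace Term

theorem subst_single_of_not_free {t : Term} (ht : ¬ Free 0 t) (u : Term) :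
    subst (single u) t = strengthen t := by
  rw [strengthen, rename_eq_subst]
  refine subst_congr ?_
  rintro (_ | i) hi
  · exact absurd hi ht
  · rfl

theorem subst_single_weaken (t u : Term) : subst (single u) (weaken t) = t := by
  rw [subst_single_of_not_free (free_weaken_zero t), strengthen_weaken]

/-- The left side is execution under a binder; the right side has the shape produced by the rules
that move a substitution across a binder. Hence propagating a marked substitution does not change
`eval`. -/
theorem subst_upSubst_single (t u : Term) :
    subst (upSubst (single u)) t = subst (single (weaken u)) (exchange t) := by
  rw [exchange, subst_rename]
  congr 1
  funext i
  rcases i with _ | _ | i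
  · simp
  · simp [weaken]
  · rw [Equiv.swap_apply_of_ne_of_ne (by omega) (by omega)]
    rfl

/-- The substitution lemma for independent bodies: the image under `eval` of the equation between
two marked substitutions. -/
theorem subst_single_subst_single (t u v : Term) :
    subst (single v) (subst (single (weaken u)) t) =
      subst (single u) (subst (upSubst (single v)) t) := by
  rw [subst_subst, subst_subst]
  congr 1
  funext i
  rcases i with _ | _ | i
  · exact subst_single_weaken u v
  · exact (subst_single_weaken v u).symm
  · rfl

end Term

/-! ## Marked substitutions -/

/-- Terms in which some explicit substitutions are marked. The body `u` of a marked substitution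
`msub t u` lives in the global scope: under `k` binders it stands for `u.rename (· + k)`. -/
inductive Marked : Type where
  | var (i : ℕ) : Marked
  | lam (t : Marked) : Marked
  | app (t u : Marked) : Marked
  | sub (t u : Marked) : Marked
  | msub (t : Marked) (u : Term) : Marked

/-- A term without marked substitutions. -/
def Term.toMarked : Term → Marked
  | .var i => .var i
  | .lam t => .lam t.toMarked
  | .app t u => .app t.toMarked u.toMarked
  | .sub t u => .sub t.toMarked u.toMarked

namespace Marked

/-- Renaming of the variables that are not in the global scope. -/
def rename : (ℕ → ℕ) → Marked → Marked
  | ρ, var i => var (ρ i)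
  | ρ, lam t => lam (rename (upRen ρ) t)
  | ρ, app t u => app (rename ρ t) (rename ρ u)
  | ρ, sub t u => sub (rename (upRen ρ) t) (rename ρ u)
  | ρ, msub t u => msub (rename (upRen ρ) t) u

/-- The term obtained under `k` binders by removing the marks. -/
def forget : ℕ → Marked → Term
  | _, var i => .var i
  | k, lam t => .lam (forget (k + 1) t)
  | k, app t u => .app (forget k t) (forget k u)
  | k, sub t u => .sub (forget (k + 1) t) (forget k u)
  | k, msub t u => .sub (forget (k + 1) t) (u.rename (· + k))

/-- The term obtained under `k` binders by executing the marked substitutions. -/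
def eval : ℕ → Marked → Term
  | _, var i => .var i
  | k, lam t => .lam (eval (k + 1) t)
  | k, app t u => .app (eval k t) (eval k u)
  | k, sub t u => .sub (eval (k + 1) t) (eval k u)
  | k, msub t u => (eval (k + 1) t).subst (single (u.rename (· + k)))

/-- All bodies of marked substitutions are strongly normalizing. -/
def WF : Marked → Prop
  | var _ => True
  | lam t => WF t
  | app t u => WF t ∧ WF u
  | sub t u => WF t ∧ WF u
  | msub t u => WF t ∧ Acc (flip Les) u

/-- A weight of the occurrences of the variable `i`; it is zero if there are none. -/
def occ : ℕ → Marked → ℕ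
  | i, var j => if i = j then 1 else 0
  | i, lam t => 2 * occ (i + 1) t
  | i, app t u => 2 * (occ i t + occ i u)
  | i, sub t u => occ (i + 1) t + 3 * occ i u
  | i, msub t _ => occ (i + 1) t

/-- The number of abstractions that a substitution can cross, disregarding substitutions. -/
def lams : Marked → ℕ
  | var _ => 0
  | lam t => lams t + 1
  | app _ _ => 0
  | sub t _ => lams t
  | msub t _ => lams t

/-- A bound on the number of propagation steps of marked substitutions, except for those across
an abstraction without an occurrence of the variable. -/
def prop : Marked → ℕ
  | var _ => 0
  | lam t => prop t
  | app t u => prop t + prop u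
  | sub t u => prop t + prop u
  | msub t _ => prop t + (1 + occ 0 t)

/-- The total number of abstractions that marked substitutions can cross. -/
def cross : Marked → ℕ
  | var _ => 0
  | lam t => cross t
  | app t u => cross t + cross u
  | sub t u => cross t + cross u
  | msub t _ => cross t + lams t

/-- The multiset of the ranks of the bodies of marked substitutions. -/
noncomputable def ranks : Marked → Multiset Ordinal
  | var _ => 0
  | lam t => ranks t
  | app t u => ranks t + ranks u
  | sub t u => ranks t + ranks u
  | msub t u => ranks t + {redRank u}

/-- See `Term.strengthen`. -/
def strengthen (t : Marked) : Marked := rename Nat.pred t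
/-- See `Term.weaken`. -/
def weaken (t : Marked) : Marked := rename Nat.succ t
/-- See `Term.exchange`. -/
def exchange (t : Marked) : Marked := rename (Equiv.swap 0 1) t

/-! ### Renaming -/

/-- The hypothesis says that `ρ` respects the global scope, which sits above `k` binders on one side
and `k'` on the other. So leaving marked bodies untouched is the correct renaming. -/
theorem forget_rename (T : Marked) : ∀ {ρ : ℕ → ℕ} {k k' : ℕ}, (∀ i, ρ (i + k) = i + k') →
    forget k' (rename ρ T) = (forget k T).rename ρ := by
  have up : ∀ {ρ : ℕ → ℕ} {k k' : ℕ}, (∀ i, ρ (i + k) = i + k') →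
      ∀ i, upRen ρ (i + (k + 1)) = i + (k' + 1) :=
    fun h i => congrArg Nat.succ (h i)
  induction T with
  | var i => exact fun _ => rfl
  | lam t ih => exact fun h => congrArg Term.lam (ih (up h))
  | app t u iht ihu => exact fun h => congrArg₂ Term.app (iht h) (ihu h)
  | sub t u iht ihu => exact fun h => congrArg₂ Term.sub (iht (up h)) (ihu h)
  | msub t u iht =>
    intro ρ k k' h
    refine congrArg₂ Term.sub (iht (up h)) ?_
    rw [rename_rename]
    exact congrArg (Term.rename · u) (funext fun i => (h i).symm)

theorem eval_rename (T : Marked) : ∀ {ρ : ℕ → ℕ} {k k' : ℕ}, (∀ i, ρ (i + k) = i + k') →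
    eval k' (rename ρ T) = (eval k T).rename ρ := by
  have up : ∀ {ρ : ℕ → ℕ} {k k' : ℕ}, (∀ i, ρ (i + k) = i + k') →
      ∀ i, upRen ρ (i + (k + 1)) = i + (k' + 1) :=
    fun h i => congrArg Nat.succ (h i)
  induction T with
  | var i => exact fun _ => rfl
  | lam t ih => exact fun h => congrArg Term.lam (ih (up h))
  | app t u iht ihu => exact fun h => congrArg₂ Term.app (iht h) (ihu h)
  | sub t u iht ihu => exact fun h => congrArg₂ Term.sub (iht (up h)) (ihu h)
  | msub t u iht =>
    intro ρ k k' h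
    simp only [rename, eval, iht (up h), subst_rename, rename_subst]
    refine Term.subst_congr ?_
    rintro (_ | i) -
    · simp only [upRen_zero, single_zero, rename_rename]
      exact congrArg (Term.rename · u) (funext fun i => (h i).symm)
    · rfl

theorem forget_strengthen (T : Marked) (k : ℕ) :
    forget k (strengthen T) = (forget (k + 1) T).strengthen := T.forget_rename fun _ => rfl
theorem eval_strengthen (T : Marked) (k : ℕ) :
    eval k (strengthen T) = (eval (k + 1) T).strengthen := T.eval_rename fun _ => rfl
theorem forget_weaken (T : Marked) (k : ℕ) :
    forget (k + 1) (weaken T) = (forget k T).weaken := T.forget_rename fun _ => rfl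
theorem eval_weaken (T : Marked) (k : ℕ) :
    eval (k + 1) (weaken T) = (eval k T).weaken := T.eval_rename fun _ => rfl

theorem _root_.LambdaES.swap_zero_one_add (i k : ℕ) :
    Equiv.swap 0 1 (i + (k + 1 + 1)) = i + (k + 1 + 1) :=
  Equiv.swap_apply_of_ne_of_ne (by omega) (by omega)

theorem forget_exchange (T : Marked) (k : ℕ) :
    forget (k + 1 + 1) (exchange T) = (forget (k + 1 + 1) T).exchange :=
  T.forget_rename fun i => swap_zero_one_add i k
theorem eval_exchange (T : Marked) (k : ℕ) :
    eval (k + 1 + 1) (exchange T) = (eval (k + 1 + 1) T).exchange :=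
  T.eval_rename fun i => swap_zero_one_add i k

@[simp] theorem lams_rename (T : Marked) : ∀ ρ, lams (rename ρ T) = lams T := by
  induction T <;> intro ρ <;> simp_all [rename, lams]

/-- Only variables that occur are constrained, since `Nat.pred` in `strengthen` is not injective. -/
theorem occ_rename (T : Marked) : ∀ {ρ : ℕ → ℕ} {i j : ℕ},
    (∀ m, 0 < occ m T → (ρ m = j ↔ m = i)) → occ j (rename ρ T) = occ i T := by
  have up : ∀ {P : ℕ → Prop} {ρ : ℕ → ℕ} {i j : ℕ}, (∀ m, P (m + 1) → (ρ m = j ↔ m = i)) →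
      ∀ m, P m → (upRen ρ m = j + 1 ↔ m = i + 1) := by
    rintro P ρ i j h (_ | m) hm
    · simp
    · simpa using h m hm
  induction T with
  | var m =>
    intro ρ i j h
    have := h m (by simp [occ])
    simp only [rename, occ, eq_comm (a := j), eq_comm (a := i), this]
  | lam t ih =>
    intro ρ i j h
    simp only [rename, occ]
    rw [ih (up (P := fun m => 0 < occ m t) fun m hm => h m (by simpa [occ] using hm))]
  | app t u iht ihu =>
    intro ρ i j h
    simp only [rename, occ]
    rw [iht fun m hm => h m (by simp only [occ]; omega),
      ihu fun m hm => h m (by simp only [occ]; omega)]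
  | sub t u iht ihu =>
    intro ρ i j h
    simp only [rename, occ]
    rw [iht (up (P := fun m => 0 < occ m t) fun m hm => h m (by simp only [occ]; omega)),
      ihu fun m hm => h m (by simp only [occ]; omega)]
  | msub t u iht =>
    intro ρ i j h
    simp only [rename, occ]
    rw [iht (up (P := fun m => 0 < occ m t) fun m hm => h m hm)]

theorem occ_rename_upRen (T : Marked) (ρ : ℕ → ℕ) : occ 0 (rename (upRen ρ) T) = occ 0 T :=
  T.occ_rename fun m _ => by cases m <;> simp

theorem occ_exchange (T : Marked) (i : ℕ) : occ i (exchange T) = occ (Equiv.swap 0 1 i) T :=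
  T.occ_rename fun m _ => by rw [Equiv.swap_apply_eq_iff]
theorem occ_exchange_zero (T : Marked) : occ 0 (exchange T) = occ 1 T := by simp [occ_exchange]
theorem occ_exchange_one (T : Marked) : occ 1 (exchange T) = occ 0 T := by simp [occ_exchange]
theorem occ_exchange_succ_succ (T : Marked) (i : ℕ) :
    occ (i + 1 + 1) (exchange T) = occ (i + 1 + 1) T := by
  rw [occ_exchange, Equiv.swap_apply_of_ne_of_ne (by omega) (by omega)]

theorem occ_weaken_zero (T : Marked) : occ 0 (weaken T) = 0 := by
  have key : ∀ (T : Marked) (n : ℕ) (ρ : ℕ → ℕ), (∀ m, ρ m ≠ n) → occ n (rename ρ T) = 0 := by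
    intro T
    have up : ∀ {n : ℕ} {ρ : ℕ → ℕ}, (∀ m, ρ m ≠ n) → ∀ m, upRen ρ m ≠ n + 1 := by
      rintro n ρ h (_ | m)
      · simp
      · simpa using h m
    induction T with
    | var m => intro n ρ h; simp [rename, occ, (h m).symm]
    | lam t ih => intro n ρ h; simp [rename, occ, ih _ _ (up h)]
    | app t u iht ihu => intro n ρ h; simp [rename, occ, iht _ _ h, ihu _ _ h]
    | sub t u iht ihu => intro n ρ h; simp [rename, occ, iht _ _ (up h), ihu _ _ h]
    | msub t u iht => intro n ρ h; simp [rename, occ, iht _ _ (up h)]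
  exact key T 0 _ Nat.succ_ne_zero
theorem occ_weaken_succ (T : Marked) (i : ℕ) : occ (i + 1) (weaken T) = occ i T :=
  T.occ_rename fun m _ => by simp
theorem occ_strengthen {T : Marked} (hT : occ 0 T = 0) (i : ℕ) :
    occ i (strengthen T) = occ (i + 1) T :=
  T.occ_rename fun m hm => by
    cases m
    · omega
    · simp

@[simp] theorem prop_rename (T : Marked) : ∀ ρ, prop (rename ρ T) = prop T := by
  induction T <;> intro ρ <;> simp_all [rename, prop, occ_rename_upRen]
@[simp] theorem cross_rename (T : Marked) : ∀ ρ, cross (rename ρ T) = cross T := by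
  induction T <;> intro ρ <;> simp_all [rename, cross]
@[simp] theorem ranks_rename (T : Marked) : ∀ ρ, ranks (rename ρ T) = ranks T := by
  induction T <;> intro ρ <;> simp_all [rename, ranks]
@[simp] theorem WF_rename (T : Marked) : ∀ ρ, WF (rename ρ T) ↔ WF T := by
  induction T <;> intro ρ <;> simp_all [rename, WF]

/-! ### Occurrences and freeness -/

theorem _root_.LambdaES.Term.not_free_rename_add (u : Term) {i k : ℕ} (h : i < k) :
    ¬ Free i (u.rename (· + k)) := by
  rw [free_rename]
  rintro ⟨j, -, hj⟩
  omega

/-- For local variables `i < k` the marked bodies contribute nothing. With `free_eval` this shows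
that the side conditions of the rules agree in `forget` and `eval`; for global variables it could
fail, as `eval` may erase bodies. -/
theorem free_forget (T : Marked) : ∀ {i k : ℕ}, i < k → (Free i (forget k T) ↔ 0 < occ i T) := by
  induction T with
  | var m => intro i k _; simp only [forget, Free, occ]; split_ifs <;> simp_all
  | lam t ih => intro i k h; simp [forget, Free, occ, ih (Nat.succ_lt_succ h)]
  | app t u iht ihu => intro i k h; simp [forget, Free, occ, iht h, ihu h]
  | sub t u iht ihu => intro i k h; simp [forget, Free, occ, iht (Nat.succ_lt_succ h), ihu h]
  | msub t u iht =>
    intro i k h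
    simp [forget, Free, occ, iht (Nat.succ_lt_succ h), u.not_free_rename_add h]

theorem free_eval (T : Marked) : ∀ {i k : ℕ}, i < k → (Free i (eval k T) ↔ 0 < occ i T) := by
  induction T with
  | var m => intro i k _; simp only [eval, Free, occ]; split_ifs <;> simp_all
  | lam t ih => intro i k h; simp [eval, Free, occ, ih (Nat.succ_lt_succ h)]
  | app t u iht ihu => intro i k h; simp [eval, Free, occ, iht h, ihu h]
  | sub t u iht ihu => intro i k h; simp [eval, Free, occ, iht (Nat.succ_lt_succ h), ihu h]
  | msub t u iht =>
    intro i k h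
    simp only [eval, free_subst, occ, ← iht (Nat.succ_lt_succ h)]
    constructor
    · rintro ⟨_ | j, hj, hi⟩
      · exact absurd hi (u.not_free_rename_add h)
      · cases hi
        exact hj
    · exact fun hi => ⟨i + 1, hi, rfl⟩

theorem free_forget_iff_eval (T : Marked) {i k : ℕ} (h : i < k) :
    Free i (forget k T) ↔ Free i (eval k T) := (T.free_forget h).trans (T.free_eval h).symm

@[simp] theorem forget_toMarked (t : Term) : ∀ k, forget k t.toMarked = t := by
  induction t <;> intro k <;> simp_all [forget, toMarked]
@[simp] theorem eval_toMarked (t : Term) : ∀ k, eval k t.toMarked = t := by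
  induction t <;> intro k <;> simp_all [eval, toMarked]
@[simp] theorem WF_toMarked (t : Term) : WF t.toMarked := by
  induction t <;> simp_all [WF, toMarked]
@[simp] theorem prop_toMarked (t : Term) : prop t.toMarked = 0 := by
  induction t <;> simp_all [prop, toMarked]

/-! ### Measures -/

/-- All measures agree. -/
structure SameMeasure (k : ℕ) (T T' : Marked) : Prop where
  occ : ∀ i < k, occ i T' = occ i T
  prop : prop T' = prop T
  lams : lams T' = lams T
  cross : cross T' = cross T
  ranks : ranks T' = ranks T

/-- The number of propagation steps, the number of crossings, and the ranks of the bodies decrease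
in the lexicographic order. -/
structure Decr (k : ℕ) (T T' : Marked) : Prop where
  occ : ∀ i < k, occ i T' = occ i T
  lt : prop T' < prop T ∨ prop T' = prop T ∧ lams T' = lams T ∧
    (cross T' < cross T ∨ cross T' = cross T ∧ Relation.CutExpand (· < ·) (ranks T') (ranks T))

namespace SameMeasure

theorem congr_lam {k : ℕ} {T T' : Marked} (h : SameMeasure (k + 1) T T') :
    SameMeasure k (.lam T) (.lam T') where
  occ i hi := by simp [Marked.occ, h.occ (i + 1) (by omega)]
  prop := h.prop
  lams := by simp [Marked.lams, h.lams]
  cross := h.cross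
  ranks := h.ranks

theorem congr_appL {k : ℕ} {T T' : Marked} (U : Marked) (h : SameMeasure k T T') :
    SameMeasure k (.app T U) (.app T' U) where
  occ i hi := by simp [Marked.occ, h.occ i hi]
  prop := by simp [Marked.prop, h.prop]
  lams := rfl
  cross := by simp [Marked.cross, h.cross]
  ranks := by simp [Marked.ranks, h.ranks]

theorem congr_appR {k : ℕ} (T : Marked) {U U' : Marked} (h : SameMeasure k U U') :
    SameMeasure k (.app T U) (.app T U') where
  occ i hi := by simp [Marked.occ, h.occ i hi]
  prop := by simp [Marked.prop, h.prop]
  lams := rfl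
  cross := by simp [Marked.cross, h.cross]
  ranks := by simp [Marked.ranks, h.ranks]

theorem congr_subL {k : ℕ} {T T' : Marked} (U : Marked) (h : SameMeasure (k + 1) T T') :
    SameMeasure k (.sub T U) (.sub T' U) where
  occ i hi := by simp [Marked.occ, h.occ (i + 1) (by omega)]
  prop := by simp [Marked.prop, h.prop]
  lams := h.lams
  cross := by simp [Marked.cross, h.cross]
  ranks := by simp [Marked.ranks, h.ranks]

theorem congr_subR {k : ℕ} (T : Marked) {U U' : Marked} (h : SameMeasure k U U') :
    SameMeasure k (.sub T U) (.sub T U') where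
  occ i hi := by simp [Marked.occ, h.occ i hi]
  prop := by simp [Marked.prop, h.prop]
  lams := rfl
  cross := by simp [Marked.cross, h.cross]
  ranks := by simp [Marked.ranks, h.ranks]

theorem congr_msub {k : ℕ} {T T' : Marked} (u : Term) (h : SameMeasure (k + 1) T T') :
    SameMeasure k (.msub T u) (.msub T' u) where
  occ i hi := by simp [Marked.occ, h.occ (i + 1) (by omega)]
  prop := by simp [Marked.prop, h.prop, h.occ 0 (by omega)]
  lams := h.lams
  cross := by simp [Marked.cross, h.cross, h.lams]
  ranks := by simp [Marked.ranks, h.ranks]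

end SameMeasure

namespace Decr

theorem congr_lam {k : ℕ} {T T' : Marked} (h : Decr (k + 1) T T') :
    Decr k (.lam T) (.lam T') where
  occ i hi := by simp [Marked.occ, h.occ (i + 1) (by omega)]
  lt := by simpa [Marked.prop, Marked.lams, Marked.cross, Marked.ranks] using h.lt

theorem congr_appL {k : ℕ} {T T' : Marked} (U : Marked) (h : Decr k T T') :
    Decr k (.app T U) (.app T' U) where
  occ i hi := by simp [Marked.occ, h.occ i hi]
  lt := by
    have := h.lt
    simp only [Marked.prop, Marked.lams, Marked.cross, Marked.ranks, Relation.cutExpand_add_right,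
      add_lt_add_iff_right, add_left_inj, true_and]
    tauto

theorem congr_appR {k : ℕ} (T : Marked) {U U' : Marked} (h : Decr k U U') :
    Decr k (.app T U) (.app T U') where
  occ i hi := by simp [Marked.occ, h.occ i hi]
  lt := by
    have := h.lt
    simp only [Marked.prop, Marked.lams, Marked.cross, Marked.ranks, Relation.cutExpand_add_left,
      add_lt_add_iff_left, add_right_inj, true_and]
    tauto

theorem congr_subL {k : ℕ} {T T' : Marked} (U : Marked) (h : Decr (k + 1) T T') :
    Decr k (.sub T U) (.sub T' U) where
  occ i hi := by simp [Marked.occ, h.occ (i + 1) (by omega)]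
  lt := by
    have := h.lt
    simp only [Marked.prop, Marked.lams, Marked.cross, Marked.ranks, Relation.cutExpand_add_right,
      add_lt_add_iff_right, add_left_inj]
    tauto

theorem congr_subR {k : ℕ} (T : Marked) {U U' : Marked} (h : Decr k U U') :
    Decr k (.sub T U) (.sub T U') where
  occ i hi := by simp [Marked.occ, h.occ i hi]
  lt := by
    have := h.lt
    simp only [Marked.prop, Marked.lams, Marked.cross, Marked.ranks, Relation.cutExpand_add_left,
      add_lt_add_iff_left, add_right_inj, true_and]
    tauto

/-- Here the invariance of `occ` and `lams` is needed: the enclosing marked substitution counts the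
former in `prop` and the latter in `cross`. A change of `lams` is harmless when `prop` drops. -/
theorem congr_msub {k : ℕ} {T T' : Marked} (u : Term) (h : Decr (k + 1) T T') :
    Decr k (.msub T u) (.msub T' u) where
  occ i hi := by simp [Marked.occ, h.occ (i + 1) (by omega)]
  lt := by
    simp only [Marked.prop, Marked.lams, Marked.cross, Marked.ranks, Relation.cutExpand_add_right,
      add_lt_add_iff_right, add_left_inj, h.occ 0 (by omega)]
    rcases h.lt with h | ⟨hp, hl, h⟩
    · exact .inl h
    · rw [hl, add_lt_add_iff_right, add_left_inj]
      exact .inr ⟨hp, rfl, h⟩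

end Decr

/-! ### Lifting steps -/

theorem _root_.LambdaES.Term.weaken_rename_add (u : Term) (k : ℕ) :
    (u.rename (· + k)).weaken = u.rename (· + (k + 1)) := by
  rw [Term.weaken, rename_rename]; rfl

/-- Only when both substitutions are unmarked does `eval` see the equation; otherwise both sides
evaluate to the same term. Marks travel with their substitutions. -/
theorem lift_root_eqCS {a b : Term} (hab : EqCS a b) (k : ℕ) (T : Marked) (hT : forget k T = a)
    (hwf : WF T) : ∃ T', WF T' ∧ forget k T' = b ∧ EquivCS (eval k T) (eval k T') ∧
      SameMeasure k T T' := by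
  cases hab with
  | cs t u v hu =>
    match T, hT, hwf with
    | sub (sub t u) v, hT, hwf =>
      obtain ⟨⟨rfl, rfl⟩, rfl⟩ : (forget _ t = _ ∧ forget _ u = _) ∧ forget _ v = _ := by
        simpa [forget] using hT
      have hu0 : Marked.occ 0 u = 0 := by simpa [free_forget] using hu
      refine ⟨sub (sub (exchange t) (weaken v)) (strengthen u), ?_, ?_, ?_, ?_, ?_, ?_, ?_, ?_⟩
      · simp_all [WF, exchange, weaken, strengthen]
      · simp [forget, forget_exchange, forget_weaken, forget_strengthen]
      · simp only [eval, eval_exchange, eval_weaken, eval_strengthen]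
        exact .of_step (.root (.cs _ _ _ (by rwa [← free_forget_iff_eval _ (by omega)])))
      · intro i hi
        simp only [Marked.occ, occ_exchange_succ_succ, occ_weaken_succ, occ_strengthen hu0]
        omega
      · simp only [Marked.prop, exchange, weaken, strengthen, prop_rename]
        omega
      · simp only [Marked.lams, exchange, lams_rename]
      · simp only [Marked.cross, exchange, weaken, strengthen, cross_rename]
        omega
      · simp only [Marked.ranks, exchange, weaken, strengthen, ranks_rename]
        abel
    | msub (sub t u) v, hT, hwf =>
      obtain ⟨⟨rfl, rfl⟩, rfl⟩ : (forget _ t = _ ∧ forget _ u = _) ∧ v.rename _ = _ := by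
        simpa [forget] using hT
      have hu0 : Marked.occ 0 u = 0 := by simpa [free_forget] using hu
      have hu' : ¬ Free 0 (eval (k + 1) u) := by rwa [← free_forget_iff_eval _ (by omega)]
      refine ⟨sub (msub (exchange t) v) (strengthen u), ?_, ?_, ?_, ?_, ?_, ?_, ?_, ?_⟩
      · simp_all [WF, exchange, strengthen]
      · simp [forget, forget_exchange, forget_strengthen, weaken_rename_add]
      · simp only [eval, eval_exchange, eval_strengthen, Term.subst]
        rw [subst_upSubst_single, subst_single_of_not_free hu', weaken_rename_add]
        exact .refl _
      · intro i hi
        simp only [Marked.occ, occ_exchange_succ_succ, occ_strengthen hu0]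
      · simp only [Marked.prop, Marked.occ, exchange, strengthen, prop_rename, zero_add]
        rw [← exchange, occ_exchange_zero]
        omega
      · simp only [Marked.lams, exchange, lams_rename]
      · simp only [Marked.cross, Marked.lams, exchange, strengthen, cross_rename, lams_rename]
        omega
      · simp only [Marked.ranks, exchange, strengthen, ranks_rename]
        abel
    | sub (msub t u) v, hT, hwf =>
      obtain ⟨⟨rfl, rfl⟩, rfl⟩ : (forget _ t = _ ∧ u.rename _ = _) ∧ forget _ v = _ := by
        simpa [forget] using hT
      refine ⟨msub (sub (exchange t) (weaken v)) u, ?_, ?_, ?_, ?_, ?_, ?_, ?_, ?_⟩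
      · simp_all [WF, exchange, weaken]
      · simp [forget, forget_exchange, forget_weaken, ← weaken_rename_add, strengthen_weaken]
      · simp only [eval, eval_exchange, eval_weaken, Term.subst]
        rw [subst_upSubst_single, subst_single_weaken, exchange_exchange, weaken_rename_add]
        exact .refl _
      · intro i hi
        simp only [Marked.occ, occ_exchange_succ_succ, occ_weaken_succ]
      · simp only [Marked.prop, Marked.occ, exchange, weaken, prop_rename, zero_add]
        rw [← exchange, ← weaken, occ_exchange_one, occ_weaken_zero]
        omega
      · simp only [Marked.lams, exchange, lams_rename]
      · simp only [Marked.cross, Marked.lams, exchange, weaken, cross_rename, lams_rename]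
        omega
      · simp only [Marked.ranks, exchange, weaken, ranks_rename]
        abel
    | msub (msub t u) v, hT, hwf =>
      obtain ⟨⟨rfl, rfl⟩, rfl⟩ : (forget _ t = _ ∧ u.rename _ = _) ∧ v.rename _ = _ := by
        simpa [forget] using hT
      refine ⟨msub (msub (exchange t) v) u, ?_, ?_, ?_, ?_, ?_, ?_, ?_, ?_⟩
      · simp_all [WF, exchange]
      · simp [forget, forget_exchange, ← weaken_rename_add, strengthen_weaken]
      · simp only [eval, eval_exchange]
        rw [← weaken_rename_add, ← weaken_rename_add, ← subst_upSubst_single,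
          subst_single_subst_single]
        exact .refl _
      · intro i hi
        simp only [Marked.occ, occ_exchange_succ_succ]
      · simp only [Marked.prop, Marked.occ, exchange, prop_rename, zero_add]
        rw [← exchange, occ_exchange_zero, occ_exchange_one]
        omega
      · simp only [Marked.lams, exchange, lams_rename]
      · simp only [Marked.cross, Marked.lams, exchange, cross_rename, lams_rename]
      · simp only [Marked.ranks, exchange, ranks_rename]
        exact add_right_comm _ _ _


theorem lift_eqCS {a b : Term} (hab : Closure EqCS a b) : ∀ (k : ℕ) (T : Marked),
    forget k T = a → WF T → ∃ T', WF T' ∧ forget k T' = b ∧ EquivCS (eval k T) (eval k T') ∧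
      SameMeasure k T T' := by
  induction hab with
  | root h => exact lift_root_eqCS h
  | @lam t t' h ih =>
    intro k T hT hwf
    match T, hT, hwf with
    | lam T, hT, hwf =>
      obtain ⟨T', hwf', rfl, he, hm⟩ := ih _ T (Term.lam.inj hT) hwf
      exact ⟨lam T', hwf', rfl, he.map .lam, hm.congr_lam⟩
  | @appL t t' u h ih =>
    intro k T hT hwf
    match T, hT, hwf with
    | app T U, hT, hwf =>
      obtain ⟨hT₁, rfl⟩ := Term.app.inj hT
      obtain ⟨T', hwf', rfl, he, hm⟩ := ih _ T hT₁ hwf.1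
      exact ⟨app T' U, ⟨hwf', hwf.2⟩, rfl, he.map (f := (Term.app · _)) (.appL _),
        hm.congr_appL U⟩
  | @appR t u u' h ih =>
    intro k T hT hwf
    match T, hT, hwf with
    | app T U, hT, hwf =>
      obtain ⟨rfl, hU⟩ := Term.app.inj hT
      obtain ⟨U', hwf', rfl, he, hm⟩ := ih _ U hU hwf.2
      exact ⟨app T U', ⟨hwf.1, hwf'⟩, rfl, he.map (.appR _), hm.congr_appR T⟩
  | @subL t t' u h ih =>
    intro k T hT hwf
    match T, hT, hwf with
    | sub T U, hT, hwf =>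
      obtain ⟨hT₁, rfl⟩ := Term.sub.inj hT
      obtain ⟨T', hwf', rfl, he, hm⟩ := ih _ T hT₁ hwf.1
      exact ⟨sub T' U, ⟨hwf', hwf.2⟩, rfl, he.map (f := (Term.sub · _)) (.subL _),
        hm.congr_subL U⟩
    | msub T v, hT, hwf =>
      obtain ⟨hT₁, rfl⟩ := Term.sub.inj hT
      obtain ⟨T', hwf', rfl, he, hm⟩ := ih _ T hT₁ hwf.1
      exact ⟨msub T' v, ⟨hwf', hwf.2⟩, rfl, he.subst _, hm.congr_msub v⟩
  | @subR t u u' h ih =>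
    intro k T hT hwf
    match T, hT, hwf with
    | sub T U, hT, hwf =>
      obtain ⟨rfl, hU⟩ := Term.sub.inj hT
      obtain ⟨U', hwf', rfl, he, hm⟩ := ih _ U hU hwf.2
      exact ⟨sub T U', ⟨hwf.1, hwf'⟩, rfl, he.map (.subR _), hm.congr_subR T⟩
    | msub T v, hT, hwf =>
      obtain ⟨rfl, rfl⟩ := Term.sub.inj hT
      -- The step takes place in the shifted body and has to be pulled back to the global scope.
      obtain ⟨v', rfl, hv⟩ := h.of_rename_add EqCS.subst EqCS.free
      have hv := EquivCS.of_step hv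
      refine ⟨msub T v', ⟨hwf.1, hv.acc hwf.2⟩, rfl, ?_, fun i hi => rfl, rfl, rfl, rfl, ?_⟩
      · refine EquivCS.subst_right _ ?_
        rintro (_ | i)
        · exact .of_step h
        · exact .refl _
      · simp only [ranks, redRank_equiv hv]

/-- A rule on an unmarked redex fires in `eval` too, while one on a marked substitution is invisible
there. The weights in `occ` pay for the latter: the factor `2` at applications covers duplication,
with `2(a+b)+1 > (a+1)+(b+1)` for `a, b ≥ 1`, and the factor `3` at bodies covers composition, with
`a+3b+1 > (a+1)+(b+1)` for `b ≥ 1`. -/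
theorem lift_root_rule {a b : Term} (hab : Rule a b) (k : ℕ) (T : Marked) (hT : forget k T = a)
    (hwf : WF T) : ∃ T', WF T' ∧ forget k T' = b ∧
      (Les (eval k T) (eval k T') ∨ eval k T' = eval k T ∧ Decr k T T') := by
  cases hab with
  | b t u =>
    match T, hT, hwf with
    | app (lam t) u, hT, hwf =>
      obtain ⟨rfl, rfl⟩ : forget _ t = _ ∧ forget _ u = _ := by simpa [forget] using hT
      exact ⟨sub t u, hwf, rfl, .inl (.of_rule (.b _ _))⟩
  | d u =>
    match T, hT, hwf with
    | sub (var x) u, hT, hwf =>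
      obtain ⟨rfl, rfl⟩ : x = 0 ∧ forget _ u = _ := by simpa [forget] using hT
      exact ⟨u, hwf.2, rfl, .inl (.of_rule (.d _))⟩
    | msub (var x) u, hT, hwf =>
      obtain ⟨rfl, rfl⟩ : x = 0 ∧ u.rename _ = _ := by simpa [forget] using hT
      -- The released body carries no marks, so its `prop` is zero. It has no local variables, which
      -- keeps `occ` invariant below `k`.
      refine ⟨(u.rename (· + k)).toMarked, by simp, by simp, .inr ⟨by simp [eval, Term.subst], ?_,
        .inl ?_⟩⟩
      · intro i hi
        have h := free_forget (u.rename (· + k)).toMarked hi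
        rw [forget_toMarked, iff_false_left (u.not_free_rename_add hi)] at h
        simpa [Marked.occ] using h
      · simp [Marked.prop]
  | w t u ht =>
    match T, hT, hwf with
    | sub t u, hT, hwf =>
      obtain ⟨rfl, rfl⟩ : forget _ t = _ ∧ forget _ u = _ := by simpa [forget] using hT
      refine ⟨strengthen t, ?_, forget_strengthen _ _, .inl ?_⟩
      · exact (WF_rename _ _).2 hwf.1
      · rw [eval_strengthen]
        exact .of_rule (.w _ _ (by rwa [← free_forget_iff_eval _ (by omega)]))
    | msub t u, hT, hwf =>
      obtain ⟨rfl, rfl⟩ : forget _ t = _ ∧ u.rename _ = _ := by simpa [forget] using hT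
      have ht0 : Marked.occ 0 t = 0 := by simpa [free_forget] using ht
      refine ⟨strengthen t, (WF_rename _ _).2 hwf.1, forget_strengthen _ _, .inr ⟨?_, ?_, .inl ?_⟩⟩
      · rw [eval_strengthen, eval,
          subst_single_of_not_free (by rwa [← free_forget_iff_eval _ (by omega)])]
      · exact fun i _ => occ_strengthen ht0 i
      · simp only [Marked.prop, strengthen, prop_rename]
        omega
  | appRight t v u ht hv =>
    match T, hT, hwf with
    | sub (app t v) u, hT, hwf =>
      obtain ⟨⟨rfl, rfl⟩, rfl⟩ : (forget _ t = _ ∧ forget _ v = _) ∧ forget _ u = _ := by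
        simpa [forget] using hT
      rw [free_forget_iff_eval _ (by omega)] at ht hv
      refine ⟨app (strengthen t) (sub v u), ?_, ?_, .inl ?_⟩
      · simp_all [WF, strengthen]
      · simp [forget, forget_strengthen]
      · simp only [eval, eval_strengthen]
        exact .of_rule (.appRight _ _ _ ht hv)
    | msub (app t v) u, hT, hwf =>
      obtain ⟨⟨rfl, rfl⟩, rfl⟩ : (forget _ t = _ ∧ forget _ v = _) ∧ u.rename _ = _ := by
        simpa [forget] using hT
      have ht0 : Marked.occ 0 t = 0 := by simpa [free_forget] using ht
      have hv0 : 0 < Marked.occ 0 v := by simpa [free_forget] using hv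
      rw [free_forget_iff_eval _ (by omega)] at ht
      refine ⟨app (strengthen t) (msub v u), ?_, ?_, .inr ⟨?_, ?_, .inl ?_⟩⟩
      · simp_all [WF, strengthen]
      · simp [forget, forget_strengthen]
      · simp only [eval, Term.subst, eval_strengthen, subst_single_of_not_free ht]
      · intro i _
        simp only [Marked.occ, occ_strengthen ht0]
      · simp only [Marked.prop, Marked.occ, strengthen, prop_rename]
        omega
  | appLeft t v u ht hv =>
    match T, hT, hwf with
    | sub (app t v) u, hT, hwf =>
      obtain ⟨⟨rfl, rfl⟩, rfl⟩ : (forget _ t = _ ∧ forget _ v = _) ∧ forget _ u = _ := by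
        simpa [forget] using hT
      rw [free_forget_iff_eval _ (by omega)] at ht hv
      refine ⟨app (sub t u) (strengthen v), ?_, ?_, .inl ?_⟩
      · simp_all [WF, strengthen]
      · simp [forget, forget_strengthen]
      · simp only [eval, eval_strengthen]
        exact .of_rule (.appLeft _ _ _ ht hv)
    | msub (app t v) u, hT, hwf =>
      obtain ⟨⟨rfl, rfl⟩, rfl⟩ : (forget _ t = _ ∧ forget _ v = _) ∧ u.rename _ = _ := by
        simpa [forget] using hT
      have ht0 : 0 < Marked.occ 0 t := by simpa [free_forget] using ht
      have hv0 : Marked.occ 0 v = 0 := by simpa [free_forget] using hv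
      rw [free_forget_iff_eval _ (by omega)] at hv
      refine ⟨app (msub t u) (strengthen v), ?_, ?_, .inr ⟨?_, ?_, .inl ?_⟩⟩
      · simp_all [WF, strengthen]
      · simp [forget, forget_strengthen]
      · simp only [eval, Term.subst, eval_strengthen, subst_single_of_not_free hv]
      · intro i _
        simp only [Marked.occ, occ_strengthen hv0]
      · simp only [Marked.prop, Marked.occ, strengthen, prop_rename]
        omega
  | appBoth t v u ht hv =>
    match T, hT, hwf with
    | sub (app t v) u, hT, hwf =>
      obtain ⟨⟨rfl, rfl⟩, rfl⟩ : (forget _ t = _ ∧ forget _ v = _) ∧ forget _ u = _ := by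
        simpa [forget] using hT
      rw [free_forget_iff_eval _ (by omega)] at ht hv
      refine ⟨app (sub t u) (sub v u), ?_, rfl, .inl (.of_rule (.appBoth _ _ _ ht hv))⟩
      simp_all [WF]
    | msub (app t v) u, hT, hwf =>
      obtain ⟨⟨rfl, rfl⟩, rfl⟩ : (forget _ t = _ ∧ forget _ v = _) ∧ u.rename _ = _ := by
        simpa [forget] using hT
      have ht0 : 0 < Marked.occ 0 t := by simpa [free_forget] using ht
      have hv0 : 0 < Marked.occ 0 v := by simpa [free_forget] using hv
      refine ⟨app (msub t u) (msub v u), ?_, rfl, .inr ⟨rfl, fun i _ => rfl, .inl ?_⟩⟩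
      · simp_all [WF]
      · simp only [Marked.prop, Marked.occ]
        omega
  | lam t u =>
    match T, hT, hwf with
    | sub (lam t) u, hT, hwf =>
      obtain ⟨rfl, rfl⟩ : forget _ t = _ ∧ forget _ u = _ := by simpa [forget] using hT
      refine ⟨lam (sub (exchange t) (weaken u)), ?_, ?_, .inl ?_⟩
      · simp_all [WF, exchange, weaken]
      · simp [forget, forget_exchange, forget_weaken]
      · simp only [eval, eval_exchange, eval_weaken]
        exact .of_rule (.lam _ _)
    | msub (lam t) u, hT, hwf =>
      obtain ⟨rfl, rfl⟩ : forget _ t = _ ∧ u.rename _ = _ := by simpa [forget] using hT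
      refine ⟨lam (msub (exchange t) u), ?_, ?_, .inr ⟨?_, ?_, ?_⟩⟩
      · simp_all [WF, exchange]
      · simp [forget, forget_exchange, weaken_rename_add]
      · simp only [eval, eval_exchange, Term.subst, subst_upSubst_single, weaken_rename_add]
      · intro i _
        simp only [Marked.occ, occ_exchange_succ_succ]
      · simp only [Marked.prop, Marked.occ, Marked.lams, Marked.cross, occ_exchange_zero, zero_add]
        simp only [exchange, prop_rename, lams_rename, cross_rename]
        -- A void substitution crossing an abstraction leaves `prop` fixed, since twice zero is
        -- zero; then `cross` loses one.
        rcases Nat.eq_zero_or_pos (Marked.occ 1 t) with h | h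
        · exact .inr ⟨by omega, trivial, .inl (by omega)⟩
        · exact .inl (by omega)
  | comp₁ t u v ht hu =>
    match T, hT, hwf with
    | sub (sub t u) v, hT, hwf =>
      obtain ⟨⟨rfl, rfl⟩, rfl⟩ : (forget _ t = _ ∧ forget _ u = _) ∧ forget _ v = _ := by
        simpa [forget] using hT
      rw [free_forget_iff_eval _ (by omega)] at ht hu
      refine ⟨sub (strengthen (exchange t)) (sub u v), ?_, ?_, .inl ?_⟩
      · simp_all [WF, exchange, strengthen]
      · simp [forget, forget_strengthen, forget_exchange]
      · simp only [eval, eval_strengthen, eval_exchange]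
        exact .of_rule (.comp₁ _ _ _ ht hu)
    | msub (sub t u) v, hT, hwf =>
      obtain ⟨⟨rfl, rfl⟩, rfl⟩ : (forget _ t = _ ∧ forget _ u = _) ∧ v.rename _ = _ := by
        simpa [forget] using hT
      have ht0 : Marked.occ 1 t = 0 := by simpa [free_forget] using ht
      have hu0 : 0 < Marked.occ 0 u := by simpa [free_forget] using hu
      rw [free_forget_iff_eval _ (by omega), ← free_exchange_zero] at ht
      rw [← occ_exchange_zero] at ht0
      refine ⟨sub (strengthen (exchange t)) (msub u v), ?_, ?_, .inr ⟨?_, ?_, .inl ?_⟩⟩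
      · simp_all [WF, exchange, strengthen]
      · simp [forget, forget_strengthen, forget_exchange]
      · simp only [eval, eval_strengthen, eval_exchange, Term.subst, subst_upSubst_single,
          subst_single_of_not_free ht]
      · intro i _
        simp only [Marked.occ, occ_strengthen ht0, occ_exchange_succ_succ]
      · simp only [Marked.prop, Marked.occ, exchange, strengthen, prop_rename]
        omega
    | sub (msub t u) v, hT, hwf =>
      obtain ⟨⟨-, rfl⟩, -⟩ : (forget _ t = _ ∧ u.rename _ = _) ∧ forget _ v = _ := by
        simpa [forget] using hT
      -- Composition would need a local variable free in a marked body.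
      exact absurd hu (u.not_free_rename_add (Nat.succ_pos k))
    | msub (msub t u) v, hT, hwf =>
      obtain ⟨⟨-, rfl⟩, -⟩ : (forget _ t = _ ∧ u.rename _ = _) ∧ v.rename _ = _ := by
        simpa [forget] using hT
      exact absurd hu (u.not_free_rename_add (Nat.succ_pos k))
  | comp₂ t u v ht hu =>
    match T, hT, hwf with
    | sub (sub t u) v, hT, hwf =>
      obtain ⟨⟨rfl, rfl⟩, rfl⟩ : (forget _ t = _ ∧ forget _ u = _) ∧ forget _ v = _ := by
        simpa [forget] using hT
      rw [free_forget_iff_eval _ (by omega)] at ht hu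
      refine ⟨sub (sub (exchange t) (weaken v)) (sub u v), ?_, ?_, .inl ?_⟩
      · simp_all [WF, exchange, weaken]
      · simp [forget, forget_weaken, forget_exchange]
      · simp only [eval, eval_weaken, eval_exchange]
        exact .of_rule (.comp₂ _ _ _ ht hu)
    | msub (sub t u) v, hT, hwf =>
      obtain ⟨⟨rfl, rfl⟩, rfl⟩ : (forget _ t = _ ∧ forget _ u = _) ∧ v.rename _ = _ := by
        simpa [forget] using hT
      have ht0 : 0 < Marked.occ 1 t := by simpa [free_forget] using ht
      have hu0 : 0 < Marked.occ 0 u := by simpa [free_forget] using hu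
      refine ⟨sub (msub (exchange t) v) (msub u v), ?_, ?_, .inr ⟨?_, ?_, .inl ?_⟩⟩
      · simp_all [WF, exchange]
      · simp [forget, forget_exchange, weaken_rename_add]
      · simp only [eval, eval_exchange, Term.subst, subst_upSubst_single, weaken_rename_add]
      · intro i _
        simp only [Marked.occ, occ_exchange_succ_succ]
      · simp only [Marked.prop, Marked.occ, occ_exchange_zero, zero_add]
        simp only [exchange, prop_rename]
        omega
    | sub (msub t u) v, hT, hwf =>
      obtain ⟨⟨-, rfl⟩, -⟩ : (forget _ t = _ ∧ u.rename _ = _) ∧ forget _ v = _ := by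
        simpa [forget] using hT
      exact absurd hu (u.not_free_rename_add (Nat.succ_pos k))
    | msub (msub t u) v, hT, hwf =>
      obtain ⟨⟨-, rfl⟩, -⟩ : (forget _ t = _ ∧ u.rename _ = _) ∧ v.rename _ = _ := by
        simpa [forget] using hT
      exact absurd hu (u.not_free_rename_add (Nat.succ_pos k))

open Relation in
theorem lift_rule {a b : Term} (hab : Closure Rule a b) : ∀ (k : ℕ) (T : Marked),
    forget k T = a → WF T → ∃ T', WF T' ∧ forget k T' = b ∧
      (TransGen Les (eval k T) (eval k T') ∨ eval k T' = eval k T ∧ Decr k T T') := by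
  induction hab with
  | root h =>
    intro k T hT hwf
    obtain ⟨T', hwf', hT', h⟩ := lift_root_rule h k T hT hwf
    exact ⟨T', hwf', hT', h.imp_left .single⟩
  | @lam t t' h ih =>
    intro k T hT hwf
    match T, hT, hwf with
    | lam T, hT, hwf =>
      obtain ⟨T', hwf', rfl, hs⟩ := ih _ T (Term.lam.inj hT) hwf
      exact ⟨lam T', hwf', rfl,
        hs.imp (fun h => h.lift Term.lam fun _ _ => Les.lam)
        fun h => ⟨congrArg Term.lam h.1, h.2.congr_lam⟩⟩
  | @appL t t' u h ih =>
    intro k T hT hwf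
    match T, hT, hwf with
    | app T U, hT, hwf =>
      obtain ⟨hT₁, rfl⟩ := Term.app.inj hT
      obtain ⟨T', hwf', rfl, hs⟩ := ih _ T hT₁ hwf.1
      exact ⟨app T' U, ⟨hwf', hwf.2⟩, rfl,
        hs.imp (fun h => h.lift (Term.app · _) fun _ _ => Les.appL _)
        fun h => ⟨congrArg (Term.app · _) h.1, h.2.congr_appL U⟩⟩
  | @appR t u u' h ih =>
    intro k T hT hwf
    match T, hT, hwf with
    | app T U, hT, hwf =>
      obtain ⟨rfl, hU⟩ := Term.app.inj hT
      obtain ⟨U', hwf', rfl, hs⟩ := ih _ U hU hwf.2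
      exact ⟨app T U', ⟨hwf.1, hwf'⟩, rfl,
        hs.imp (fun h => h.lift (Term.app _) fun _ _ => Les.appR _)
        fun h => ⟨congrArg (Term.app _) h.1, h.2.congr_appR T⟩⟩
  | @subL t t' u h ih =>
    intro k T hT hwf
    match T, hT, hwf with
    | sub T U, hT, hwf =>
      obtain ⟨hT₁, rfl⟩ := Term.sub.inj hT
      obtain ⟨T', hwf', rfl, hs⟩ := ih _ T hT₁ hwf.1
      exact ⟨sub T' U, ⟨hwf', hwf.2⟩, rfl,
        hs.imp (fun h => h.lift (Term.sub · _) fun _ _ => Les.subL _)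
        fun h => ⟨congrArg (Term.sub · _) h.1, h.2.congr_subL U⟩⟩
    | msub T v, hT, hwf =>
      obtain ⟨hT₁, rfl⟩ := Term.sub.inj hT
      obtain ⟨T', hwf', rfl, hs⟩ := ih _ T hT₁ hwf.1
      exact ⟨msub T' v, ⟨hwf', hwf.2⟩, rfl,
        hs.imp (fun h => h.lift _ fun _ _ h => h.subst _)
        fun h => ⟨congrArg (Term.subst _) h.1, h.2.congr_msub v⟩⟩
  | @subR t u u' h ih =>
    intro k T hT hwf
    match T, hT, hwf with
    | sub T U, hT, hwf =>
      obtain ⟨rfl, hU⟩ := Term.sub.inj hT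
      obtain ⟨U', hwf', rfl, hs⟩ := ih _ U hU hwf.2
      exact ⟨sub T U', ⟨hwf.1, hwf'⟩, rfl,
        hs.imp (fun h => h.lift (Term.sub _) fun _ _ => Les.subR _)
        fun h => ⟨congrArg (Term.sub _) h.1, h.2.congr_subR T⟩⟩
    | msub T v, hT, hwf =>
      obtain ⟨rfl, rfl⟩ := Term.sub.inj hT
      obtain ⟨v', rfl, hv⟩ := h.of_rename_add Rule.subst Rule.free
      have hv := Les.of_step hv
      refine ⟨msub T v', ⟨hwf.1, hwf.2.inv hv⟩, rfl, ?_⟩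
      -- `eval` copies the body any number of times. If no step results, the reduction is recorded
      -- by the smaller rank of the body.
      have he : ReflTransGen Les (eval k (msub T v)) (eval k (msub T v')) := by
        refine Les.reflTransGen_subst_right _ ?_
        rintro (_ | i)
        · exact .single (.of_step h)
        · exact .refl
      rcases reflTransGen_iff_eq_or_transGen.1 he with he | he
      · refine .inr ⟨he, fun i _ => rfl, .inr ⟨rfl, rfl, .inr ⟨rfl, ?_⟩⟩⟩
        exact cutExpand_add_single _ (redRank_lt hwf.2 hv)
      · exact .inl he

/-! ### Lifting reduction modulo the equation, and strong normalization of marked terms -/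

theorem lift_equivCS {a b : Term} (hab : EquivCS a b) (k : ℕ) (T : Marked) (hT : forget k T = a)
    (hwf : WF T) : ∃ T', WF T' ∧ forget k T' = b ∧ EquivCS (eval k T) (eval k T') ∧
      SameMeasure k T T' := by
  rw [EquivCS.iff_reflTransGen] at hab
  induction hab with
  | refl => exact ⟨T, hwf, hT, .refl _, fun _ _ => rfl, rfl, rfl, rfl, rfl⟩
  | tail _ hbc ih =>
    obtain ⟨T₁, hwf₁, hT₁, he₁, hm₁⟩ := ih
    obtain ⟨T₂, hwf₂, hT₂, he₂, hm₂⟩ := lift_eqCS hbc k T₁ hT₁ hwf₁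
    exact ⟨T₂, hwf₂, hT₂, he₁.trans he₂, fun i hi => (hm₂.occ i hi).trans (hm₁.occ i hi),
      hm₂.prop.trans hm₁.prop, hm₂.lams.trans hm₁.lams, hm₂.cross.trans hm₁.cross,
      hm₂.ranks.trans hm₁.ranks⟩

open Relation in
theorem lift_les {T : Marked} {k : ℕ} {b : Term} (h : Les (forget k T) b) (hwf : WF T) :
    ∃ T', WF T' ∧ forget k T' = b ∧ (TransGen Les (eval k T) (eval k T') ∨
      EquivCS (eval k T) (eval k T') ∧ (prop T' < prop T ∨ prop T' = prop T ∧
        (cross T' < cross T ∨ cross T' = cross T ∧ CutExpand (· < ·) (ranks T') (ranks T)))) := by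
  obtain ⟨a, c, hTa, hac, hcb⟩ := h
  obtain ⟨T₁, hwf₁, hT₁, he₁, hm₁⟩ := lift_equivCS hTa k T rfl hwf
  obtain ⟨T₂, hwf₂, hT₂, h₂⟩ := lift_rule hac k T₁ hT₁ hwf₁
  obtain ⟨T₃, hwf₃, hT₃, he₃, hm₃⟩ := lift_equivCS hcb k T₂ hT₂ hwf₂
  refine ⟨T₃, hwf₃, hT₃, h₂.imp (fun h => ?_) (fun ⟨he, h⟩ => ⟨?_, ?_⟩)⟩
  -- The equivalences before and after are absorbed into the first and last step of the sequence.
  · obtain ⟨d, hd, hdT⟩ := TransGen.head'_iff.1 h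
    obtain ⟨e, hde, he⟩ := TransGen.tail'_iff.1 (TransGen.head' (hd.equiv_left he₁) hdT)
    exact TransGen.tail' hde (he.equiv_right he₃)
  · rw [he] at he₃
    exact he₁.trans he₃
  · rw [hm₃.prop, hm₃.cross, hm₃.ranks, ← hm₁.prop, ← hm₁.cross, ← hm₁.ranks]
    have := h.lt
    tauto

/-- Marked substitutions, whose bodies are strongly normalizing, need not be executed to obtain
strong normalization. -/
theorem acc_forget {k : ℕ} {s : Term} (hs : Acc (flip Les) s) :
    ∀ T : Marked, WF T → EquivCS s (eval k T) → Acc (flip Les) (forget k T) := by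
  replace hs := hs.transGen
  induction hs with
  | intro s _ ih =>
    -- Lexicographic induction on the triple, nested inside the induction on `s`: a visible step
    -- decreases `s` and may reset all three components.
    suffices key : ∀ (p c : ℕ) (r : Multiset Ordinal) (T : Marked), prop T = p → cross T = c →
        ranks T = r → WF T → EquivCS s (eval k T) → Acc (flip Les) (forget k T) from
      fun T => key _ _ _ T rfl rfl rfl
    intro p
    induction p using Nat.strong_induction_on with
    | h p ihp =>
    intro c
    induction c using Nat.strong_induction_on with
    | h c ihc =>
    intro r
    induction r using (WellFounded.cutExpand (r := (· < ·)) (α := Ordinal) wellFounded_lt).induction with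
    | h r ihr =>
    intro T hp hc hr hwf hsT
    refine ⟨_, fun b hb => ?_⟩
    obtain ⟨T', hwf', rfl, h | ⟨he, hlt⟩⟩ := lift_les hb hwf
    · obtain ⟨d, hd, hdT⟩ := Relation.TransGen.head'_iff.1 h
      refine ih (eval k T') ?_ T' hwf' (.refl _)
      rw [Relation.transGen_swap]
      exact Relation.TransGen.head' (hd.equiv_left hsT) hdT
    · have hsT' := hsT.trans he
      subst hp hc hr
      rcases hlt with h | ⟨hp, h | ⟨hc, h⟩⟩
      · exact ihp _ h _ _ T' rfl rfl rfl hwf' hsT'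
      · exact ihc _ h _ T' hp rfl rfl hwf' hsT'
      · exact ihr _ h T' hp hc rfl hwf' hsT'

end Marked

/-! ## Abstractions, neutral terms and head redexes -/

theorem EquivCS.var_inv {i : ℕ} {b : Term} (h : EquivCS (.var i) b) : b = .var i := by
  rw [iff_reflTransGen] at h
  induction h with
  | refl => rfl
  | tail _ hbc ih =>
    subst ih
    cases hbc with
    | root h => cases h

theorem EquivCS.lam_inv {t b : Term} (h : EquivCS (.lam t) b) :
    ∃ t', b = .lam t' ∧ EquivCS t t' := by
  rw [iff_reflTransGen] at h
  induction h with
  | refl => exact ⟨t, rfl, .refl _⟩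
  | tail _ hbc ih =>
    obtain ⟨t', rfl, ht'⟩ := ih
    cases hbc with
    | root h => cases h
    | lam h => exact ⟨_, rfl, ht'.trans (.of_step h)⟩

theorem EquivCS.app_inv {t u b : Term} (h : EquivCS (.app t u) b) :
    ∃ t' u', b = .app t' u' ∧ EquivCS t t' ∧ EquivCS u u' := by
  rw [iff_reflTransGen] at h
  induction h with
  | refl => exact ⟨t, u, rfl, .refl _, .refl _⟩
  | tail _ hbc ih =>
    obtain ⟨t', u', rfl, ht', hu'⟩ := ih
    cases hbc with
    | root h => cases h
    | appL _ h => exact ⟨_, _, rfl, ht'.trans (.of_step h), hu'⟩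
    | appR _ h => exact ⟨_, _, rfl, ht', hu'.trans (.of_step h)⟩

theorem acc_lam {t : Term} (ht : Acc (flip Les) t) : Acc (flip Les) (.lam t) := by
  induction ht with
  | intro t _ ih =>
    refine ⟨_, ?_⟩
    rintro b ⟨a, c, hta, hac, hcb⟩
    obtain ⟨t₁, rfl, h₁⟩ := hta.lam_inv
    cases hac with
    | root h => cases h
    | lam h =>
      obtain ⟨t₃, rfl, h₃⟩ := hcb.lam_inv
      exact ih t₃ ⟨_, _, h₁, h, h₃⟩

/-- A variable applied to terms. -/
inductive Neutral : Term → Prop where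
  | var (i : ℕ) : Neutral (.var i)
  | app {t : Term} (u : Term) : Neutral t → Neutral (.app t u)

namespace Neutral

/-- The hypotheses on `R` hold for both the rules and the equation. A neutral function part is never
an abstraction, so no root step applies. -/
theorem step {R : Term → Term → Prop} (hv : ∀ i b, ¬ R (.var i) b)
    (ha : ∀ t u b, R (.app t u) b → ∃ t', t = .lam t') {t t' : Term} (ht : Neutral t)
    (h : Closure R t t') : Neutral t' := by
  induction ht generalizing t' with
  | var i =>
    cases h with
    | root h => exact absurd h (hv _ _)
  | app u ht ih =>
    cases h with
    | root h =>
      obtain ⟨_, rfl⟩ := ha _ _ _ h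
      cases ht
    | appL _ h => exact .app _ (ih h)
    | appR _ h => exact .app _ ht

theorem equivCS {t t' : Term} (ht : Neutral t) (h : EquivCS t t') : Neutral t' := by
  rw [EquivCS.iff_reflTransGen] at h
  induction h with
  | refl => exact ht
  | tail _ hbc ih => exact ih.step (fun _ _ h => nomatch h) (fun _ _ _ h => nomatch h) hbc

theorem les {t t' : Term} (ht : Neutral t) : Les t t' → Neutral t' :=
  fun ⟨_, _, ha, hab, hb⟩ => ((ht.equivCS ha).step (fun _ _ h => nomatch h)
    (fun _ _ _ h => by cases h; exact ⟨_, rfl⟩) hab).equivCS hb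

theorem acc_app {t : Term} (ht : Acc (flip Les) t) (hn : Neutral t) {u : Term}
    (hu : Acc (flip Les) u) : Acc (flip Les) (.app t u) := by
  induction ht generalizing u with
  | intro t _ iht =>
    induction hu with
    | intro u hu ihu =>
      refine ⟨_, ?_⟩
      rintro b ⟨a, c, hta, hac, hcb⟩
      obtain ⟨t₁, u₁, rfl, ht₁, hu₁⟩ := hta.app_inv
      cases hac with
      | root h =>
        cases h
        exact nomatch hn.equivCS ht₁
      | appL _ h =>
        obtain ⟨t₃, u₃, rfl, ht₃, hu₃⟩ := hcb.app_inv
        have hl : Les t t₃ := ⟨_, _, ht₁, h, ht₃⟩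
        exact iht t₃ hl (hn.les hl) ((hu₁.trans hu₃).acc ⟨u, hu⟩)
      | appR _ h =>
        obtain ⟨t₃, u₃, rfl, ht₃, hu₃⟩ := hcb.app_inv
        exact ((ht₁.trans ht₃).map (f := (Term.app · u₃)) (.appL _)).acc
          (ihu u₃ ⟨_, _, hu₁, h, hu₃⟩)

end Neutral

/-- The contraction of the head redex of a redex applied to terms. -/
inductive HeadB : Term → Term → Prop where
  | b (t u : Term) : HeadB (.app (.lam t) u) (.sub t u)
  | app {t t' : Term} (u : Term) : HeadB t t' → HeadB (.app t u) (.app t' u)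

namespace HeadB

theorem eqCS {t t' a : Term} (h : HeadB t t') (ha : Closure EqCS t a) :
    ∃ a', HeadB a a' ∧ Closure EqCS t' a' := by
  induction h generalizing a with
  | b t u =>
    cases ha with
    | root h => cases h
    | appL _ h =>
      cases h with
      | root h => cases h
      | lam h => exact ⟨_, .b _ _, .subL _ h⟩
    | appR _ h => exact ⟨_, .b _ _, .subR _ h⟩
  | app u h ih =>
    cases ha with
    | root h => cases h
    | appL _ h =>
      obtain ⟨a', h₁, h₂⟩ := ih h
      exact ⟨_, .app _ h₁, .appL _ h₂⟩
    | appR _ h' => exact ⟨_, .app _ h, .appR _ h'⟩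

theorem equivCS {t t' a : Term} (h : HeadB t t') (ha : EquivCS t a) :
    ∃ a', HeadB a a' ∧ EquivCS t' a' := by
  rw [EquivCS.iff_reflTransGen] at ha
  induction ha with
  | refl => exact ⟨t', h, .refl _⟩
  | tail _ hbc ih =>
    obtain ⟨a', h₁, h₂⟩ := ih
    obtain ⟨b', h₃, h₄⟩ := h₁.eqCS hbc
    exact ⟨b', h₃, h₂.trans (.of_step h₄)⟩

/-- Contracting to an explicit substitution copies nothing, so any other step commutes with it one
for one. -/
theorem rule {t t' a : Term} (h : HeadB t t') (ha : Closure Rule t a) :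
    a = t' ∨ ∃ a', HeadB a a' ∧ Closure Rule t' a' := by
  induction h generalizing a with
  | b t u =>
    cases ha with
    | root h =>
      cases h
      exact .inl rfl
    | appL _ h =>
      cases h with
      | root h => cases h
      | lam h => exact .inr ⟨_, .b _ _, .subL _ h⟩
    | appR _ h => exact .inr ⟨_, .b _ _, .subR _ h⟩
  | app u h ih =>
    cases ha with
    | root h' =>
      cases h'
      cases h
    | appL _ h =>
      obtain rfl | ⟨a', h₁, h₂⟩ := ih h
      · exact .inl rfl
      · exact .inr ⟨_, .app _ h₁, .appL _ h₂⟩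
    | appR _ h' => exact .inr ⟨_, .app _ h, .appR _ h'⟩

/-- Steps of `t` other than the head contraction are mirrored by steps of `t'`, so they cannot go on
forever; after the head contraction the term is a descendant of `t'` itself. -/
theorem acc {t t' : Term} (ht' : Acc (flip Les) t') (h : HeadB t t') : Acc (flip Les) t := by
  induction ht' generalizing t with
  | intro t' ht' ih =>
    refine ⟨_, ?_⟩
    rintro b ⟨a, c, hta, hac, hcb⟩
    obtain ⟨a', ha', hta'⟩ := h.equivCS hta
    obtain rfl | ⟨c', hc', hac'⟩ := ha'.rule hac
    · exact (hta'.trans hcb).acc ⟨_, ht'⟩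
    · obtain ⟨b', hb', hcb'⟩ := hc'.equivCS hcb
      exact ih b' ⟨_, _, hta', hac', hcb'⟩ hb'

end HeadB

/-! ## Lambda-terms -/

/-- Immediate subterms. -/
inductive Lam.Child : Lam → Lam → Prop where
  | lam (t : Lam) : Child t (.lam t)
  | appL (t u : Lam) : Child t (.app t u)
  | appR (t u : Lam) : Child u (.app t u)

namespace Lam

open Relation

theorem Child.beta {s s' t : Lam} (h : ReflTransGen Child s t) (hs : Beta s s') :
    ∃ t', Beta t t' ∧ ReflTransGen Child s' t' := by
  induction h with
  | refl => exact ⟨s', hs, .refl⟩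
  | tail _ hbc ih =>
    obtain ⟨t', h₁, h₂⟩ := ih
    cases hbc with
    | lam t => exact ⟨_, .lam h₁, h₂.tail (.lam _)⟩
    | appL t u => exact ⟨_, .appL _ h₁, h₂.tail (.appL _ _)⟩
    | appR t u => exact ⟨_, .appR _ h₁, h₂.tail (.appR _ _)⟩

/-- Strong normalization allows induction on reduction and subterms at the same time. -/
theorem acc_beta_or_child {t : Lam} (ht : Acc (flip Beta) t) :
    Acc (fun s t => Beta t s ∨ Child s t) t := by
  -- The claim is extended to all subterms, since a β-reduct of a subterm of `t` is a subterm of a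
  -- β-reduct of `t`.
  suffices key : ∀ s, ReflTransGen Child s t → Acc (fun s t => Beta t s ∨ Child s t) s from
    key t .refl
  induction ht with
  | intro t _ ih =>
    have step : ∀ s, ReflTransGen Child s t →
        (∀ s', Child s' s → Acc (fun s t => Beta t s ∨ Child s t) s') →
        Acc (fun s t => Beta t s ∨ Child s t) s := by
      refine fun s hs hc => ⟨_, fun s' h => h.elim (fun h => ?_) (hc s')⟩
      obtain ⟨t', h₁, h₂⟩ := Child.beta hs h
      exact ih t' h₁ s' h₂
    intro s
    induction s with
    | var i => exact fun hs => step _ hs fun _ h => nomatch h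
    | lam s ihs =>
      refine fun hs => step _ hs ?_
      rintro _ ⟨⟩
      exact ihs (hs.head (.lam _))
    | app s r ihs ihr =>
      refine fun hs => step _ hs ?_
      rintro _ (_ | _)
      · exact ihs (hs.head (.appL _ _))
      · exact ihr (hs.head (.appR _ _))

theorem toTerm_rename (t : Lam) : ∀ ρ, (t.rename ρ).toTerm = t.toTerm.rename ρ := by
  induction t <;> intro ρ <;> simp_all [rename, toTerm, Term.rename]

theorem toTerm_subst (t : Lam) : ∀ σ : ℕ → Lam,
    (t.subst σ).toTerm = t.toTerm.subst fun i => (σ i).toTerm := by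
  have up : ∀ σ : ℕ → Lam, (fun i => (upSubst σ i).toTerm) =
      Term.upSubst fun i => (σ i).toTerm := by
    intro σ; funext i
    cases i
    · rfl
    · exact toTerm_rename _ _
  induction t <;> intro σ <;> simp_all [subst, toTerm, Term.subst]

theorem toTerm_inst (t u : Lam) : (t.inst u).toTerm = t.toTerm.subst (single u.toTerm) := by
  rw [inst, toTerm_subst]
  congr 1
  funext i
  cases i <;> rfl

/-- A lambda-term is an abstraction, neutral, or has a head redex. In the last case, contracting
the redex into an explicit substitution gives a term that becomes the beta-contractum when that
substitution is executed. -/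
theorem cases_head (t : Lam) : (∃ s, t = lam s) ∨ Neutral t.toTerm ∨
    ∃ (r u : Lam) (T : Marked), Beta t r ∧ TransGen Child u t ∧
      HeadB t.toTerm (T.forget 0) ∧ T.eval 0 = r.toTerm ∧ (Acc (flip Les) u.toTerm → T.WF) := by
  induction t with
  | var i => exact .inr (.inl (.var i))
  | lam t _ => exact .inl ⟨t, rfl⟩
  | app t v ih _ =>
    obtain ⟨s, rfl⟩ | hn | ⟨r, u, T, h₁, h₂, h₃, h₄, h₅⟩ := ih
    · refine .inr (.inr ⟨s.inst v, v, .msub s.toTerm.toMarked v.toTerm, .beta _ _,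
        .single (.appR _ _), ?_, ?_, fun h => ⟨Marked.WF_toMarked _, h⟩⟩)
      · have : v.toTerm.rename (· + 0) = v.toTerm := by
          rw [rename_eq_subst]
          exact subst_var _
        simp only [Marked.forget, Marked.forget_toMarked, this]
        exact .b _ _
      · have : v.toTerm.rename (· + 0) = v.toTerm := by
          rw [rename_eq_subst]
          exact subst_var _
        simp only [Marked.eval, Marked.eval_toMarked, this, toTerm_inst]
    · exact .inr (.inl (.app _ hn))
    · refine .inr (.inr ⟨.app r v, u, .app T v.toTerm.toMarked, .appL _ h₁, h₂.tail (.appL _ _),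
        ?_, ?_, fun h => ⟨h₅ h, Marked.WF_toMarked _⟩⟩)
      · simp only [Marked.forget, Marked.forget_toMarked]
        exact .app _ h₃
      · simp only [Marked.eval, Marked.eval_toMarked, h₄, toTerm]

theorem acc_toTerm {t : Lam} (ht : Acc (flip Beta) t) : Acc (flip Les) t.toTerm := by
  replace ht := (acc_beta_or_child ht).transGen
  induction ht with
  | intro t _ ih =>
    have child : ∀ {s}, Child s t → Acc (flip Les) s.toTerm := fun h => ih _ (.single (.inr h))
    obtain ⟨s, rfl⟩ | hn | ⟨r, u, T, h₁, h₂, h₃, h₄, h₅⟩ := t.cases_head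
    · exact acc_lam (child (.lam s))
    · cases t with
      | var i =>
        refine ⟨_, ?_⟩
        rintro b ⟨a, c, ha, hac, -⟩
        cases EquivCS.var_inv ha
        cases hac with
        | root h => cases h
      | lam s => exact acc_lam (child (.lam s))
      | app s r =>
        cases hn with
        | app _ hn => exact hn.acc_app (child (.appL s r)) (child (.appR s r))
    · have hu : Acc (flip Les) u.toTerm := ih u (TransGen.mono (fun _ _ => .inr) _ _ h₂)
      have hr : Acc (flip Les) r.toTerm := ih r (.single (.inl h₁))
      -- The marked term `T` evaluates to the β-reduct `r`, and its marked body is the proper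
      -- subterm `u`; both are below `t`.
      exact h₃.acc (Marked.acc_forget hr T (h₅ hu) (by rw [h₄]; exact .refl _))

end Lam

end LambdaES

theorem mainTheorem9 :
    ∀ t : LambdaES.Lam, LambdaES.SN LambdaES.Beta t → LambdaES.SN LambdaES.Les t.toTerm := by
  intro t ht
  rw [LambdaES.SN_iff_acc] at ht ⊢
  exact LambdaES.Lam.acc_toTerm ht
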